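/- Let $r\ge 0$ and let $n_1,\dots,n_r$ be positive integers, $N=n_1\cdots n_r$. (The case $r=2$, $(n_1,n_2)=(n,m)$, gives $\mathcal M_1(\mathrm{GL}(n))\times\mathcal M_1(\mathrm{GL}(m))\to\mathcal M_2(\mathrm{GL}(nm))$.) All varieties are over $\mathbb C$, and the GIT quotient of an affine variety $X$ by a group $G$ is $X/\!\!/G=\mathrm{Spec}(\mathbb C[X]^G)$; write $[x]$ for the image of a point $x\in X$. Define - $\mathcal M_s(\mathrm{GL}(k))=\mathrm{Hom}(\mathbb Z^s,\mathrm{GL}(k,\mathbb C))/\!\!/\mathrm{GL}(k,\mathbb C)$, the action being conjugation; - $\mathcal M(s,k)=\{(A_1,\dots,A_s)\in \mathrm{Mat}_k(\mathbb C)^s: A_iA_j=A_jA_i\}/\!\!/\mathrm{GL}(k,\mathbb C)$, the action being simultaneous conjugation; this is the moduli space of $k$-dimensional representations of the quiver with one vertex and $s$ loops that satisfy the commutation relations (for $s=1$: of the Jordan quiver). Identify $\mathbb C^{n_1}\otimes\cdots\otimes\mathbb C^{n_r}$ with $\mathbb C^N$ by any enumeration of the multi-indices $(i_1,\dots,i_r)$,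 $1\le i_k\le n_k$, by $i\in\{1,\dots,N\}$. (1) For all $s,k\ge 0$ the map $[\rho]\mapsto[\rho(e_1),\dots,\rho(e_s)]$ is an open immersion $\mathcal M_s(\mathrm{GL}(k))\hookrightarrow\mathcal M(s,k)$ onto the distinguished open subset where $\det A_1\cdots\det A_s$ does not vanish. (2) There are unique morphisms of schemes over $\mathbb C$ $$\Phi:\prod_{k=1}^r\mathcal M(1,n_k)\to\mathcal M(r,N),\qquad F:\prod_{k=1}^r\mathcal M_1(\mathrm{GL}(n_k))\to\mathcal M_r(\mathrm{GL}(N))$$ such that $\Phi([A_1],\dots,[A_r])=[(1\otimes\cdots\otimes A_k\otimes\cdots\otimes 1)_{k=1}^r]$ for all $A_k\in\mathrm{Mat}_{n_k}(\mathbb C)$ and $F([\rho_1],\dots,[\rho_r])=[(a_1,\dots,a_r)\mapsto\rho_1(a_1)\otimes\cdots\otimes\rho_r(a_r)]$ for all $\rho_k:\mathbb Z\to\mathrm{GL}(n_k,\mathbb C)$. The morphism $F$ is the restriction of $\Phi$ along the open immersions of (1). (3) The set-theoretic image of $F$ is irreducible. Its scheme-theoretic image (the *Segre subscheme*) is a closed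 affine subscheme of $\mathcal M_r(\mathrm{GL}(N))$ whose underlying set is the closure of the set-theoretic image. (4) There is a unique homomorphism of $\mathbb C$-algebras $$\varphi:\mathbb C[\lambda^{(k)}_i: 1\le k\le r,\,1\le i\le N]^{\mathfrak S_N}\to\mathbb C[\alpha^{(1)}_1,\dots,\alpha^{(1)}_{n_1}]^{\mathfrak S_{n_1}}\otimes_{\mathbb C}\cdots\otimes_{\mathbb C}\mathbb C[\alpha^{(r)}_1,\dots,\alpha^{(r)}_{n_r}]^{\mathfrak S_{n_r}}$$ ($\mathfrak S_N$ acting on the index $i$ simultaneously for all $k$) that is given by the substitution $\lambda^{(k)}_i\mapsto\alpha^{(k)}_{i_k}$, where $i$ corresponds to $(i_1,\dots,i_r)$. It induces a homomorphism $\varphi_{\mathrm{loc}}:B\to C$ between the localizations of these rings at $\prod_{k,i}\lambda^{(k)}_i$ and at $\prod_{k,i}\alpha^{(k)}_i$ respectively. There are isomorphisms over $\mathbb C$, $\mathrm{Spec}\,B\cong\mathcal M_r(\mathrm{GL}(N))$ and $\mathrm{Spec}\,C\cong\prod_k\mathcal M_1(\mathrm{GL}(n_k))$, that send a point of the torus $(\mathbb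 C^*)^{rN}$, respectively $(\mathbb C^*)^{n_1+\cdots+n_r}$, to the class of the corresponding diagonal representation(s); under them $F$ corresponds to $\mathrm{Spec}(\varphi_{\mathrm{loc}})$, and the Segre subscheme is the closed subscheme $\mathrm{Spec}(B/\ker\varphi_{\mathrm{loc}})$. -/

import Mathlib

open CategoryTheory CategoryTheory.Limits AlgebraicGeometry
open scoped TensorProduct

noncomputable section

namespace SegreChar

/-! ### Affine schemes over the complex numbers -/

/-- `Spec A → Spec ℂ`, as a scheme over `Spec ℂ`. -/
def affOver (A : Type) [CommRing A] [Algebra ℂ A] : Over (Spec (CommRingCat.of ℂ)) :=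
  Over.mk (Spec.map (CommRingCat.ofHom (algebraMap ℂ A)))

/-- The morphism `Spec B ⟶ Spec A` over `Spec ℂ` given by a homomorphism of `ℂ`-algebras `A → B`.
For `B = ℂ` this is a `ℂ`-valued (that is, closed) point of `Spec A`. -/
def affMap {A B : Type} [CommRing A] [Algebra ℂ A] [CommRing B] [Algebra ℂ B] (f : A →ₐ[ℂ] B) :
    affOver B ⟶ affOver A :=
  Over.homMk (Spec.map (CommRingCat.ofHom f.toRingHom)) (by
    change Spec.map _ ≫ Spec.map _ = Spec.map _
    rw [← Spec.map_comp, ← CommRingCat.ofHom_comp]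
    congr 2
    exact f.comp_algebraMap)

/-! ### Affine GIT quotients

An affine variety is given by its set of points `X` and its coordinate ring, a subalgebra of the
algebra of all functions `X → ℂ`. -/

/-- The invariant regular functions on `X`, for `act : G → X → X`. -/
def invariants {G X : Type} (act : G → X → X) (O : Subalgebra ℂ (X → ℂ)) :
    Subalgebra ℂ (X → ℂ) where
  carrier := {f | f ∈ O ∧ ∀ g x, f (act g x) = f x}
  mul_mem' := fun ha hb => ⟨O.mul_mem ha.1 hb.1, fun g x => by simp [ha.2 g x, hb.2 g x]⟩
  add_mem' := fun ha hb => ⟨O.add_mem ha.1 hb.1, fun g x => by simp [ha.2 g x, hb.2 g x]⟩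
  algebraMap_mem' := fun c => ⟨O.algebraMap_mem c, fun _ _ => rfl⟩

/-- The affine GIT quotient `X // G = Spec (O(X)^G)`, as a scheme over `Spec ℂ`. -/
def gitQuotient {G X : Type} (act : G → X → X) (O : Subalgebra ℂ (X → ℂ)) :
    Over (Spec (CommRingCat.of ℂ)) :=
  affOver (invariants act O)

/-- Evaluation of invariant functions at a point of `X`. -/
def evalInv {G X : Type} (act : G → X → X) (O : Subalgebra ℂ (X → ℂ)) (x : X) :
    invariants act O →ₐ[ℂ] ℂ :=
  (Pi.evalAlgHom ℂ (fun _ : X => ℂ) x).comp (invariants act O).val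

/-- The closed point `[x]` of `X // G` that is the image of `x : X`. -/
def gitPoint {G X : Type} (act : G → X → X) (O : Subalgebra ℂ (X → ℂ)) (x : X) :
    affOver ℂ ⟶ gitQuotient act O :=
  affMap (evalInv act O x)

/-! ### Character varieties of free abelian groups -/

/-- The representation space `Hom(ℤ^r, GL(n, ℂ))`. -/
abbrev RepSpace (r n : ℕ) : Type := Multiplicative (Fin r → ℤ) →* GL (Fin n) ℂ

/-- The coordinate ring of the affine variety `Hom(ℤ^r, GL(n, ℂ))`: the functions that are
polynomials in the matrix entries `ρ ↦ ρ(a)ᵢⱼ`, `a ∈ ℤ^r`. -/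
def repCoord (r n : ℕ) : Subalgebra ℂ (RepSpace r n → ℂ) :=
  Algebra.adjoin ℂ {f | ∃ (a : Multiplicative (Fin r → ℤ)) (i j : Fin n),
    f = fun ρ => (ρ a : Matrix (Fin n) (Fin n) ℂ) i j}

/-- `GL(n, ℂ)` acts on `Hom(ℤ^r, GL(n, ℂ))` by conjugation. -/
def repConj (r n : ℕ) (g : GL (Fin n) ℂ) (ρ : RepSpace r n) : RepSpace r n :=
  (MulAut.conj g).toMonoidHom.comp ρ

/-- The character variety `M_r(GL(n, ℂ)) = Hom(ℤ^r, GL(n, ℂ)) // GL(n, ℂ)`. -/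
def charVar (r n : ℕ) : Over (Spec (CommRingCat.of ℂ)) :=
  gitQuotient (repConj r n) (repCoord r n)

/-- The closed point `[ρ]` of `M_r(GL(n, ℂ))`. -/
def charPoint {r n : ℕ} (ρ : RepSpace r n) : affOver ℂ ⟶ charVar r n :=
  gitPoint (repConj r n) (repCoord r n) ρ

/-- The `k`-th standard generator of `ℤ^r`. -/
def gen {r : ℕ} (k : Fin r) : Multiplicative (Fin r → ℤ) :=
  Multiplicative.ofAdd (Pi.single k 1)

/-! ### Moduli of representations of the `r`-fold tensor power of the Jordan quiver

This quiver has one vertex and `r` loops, so an `n`-dimensional representation that satisfies the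
relations `α_k α_l - α_l α_k` is an `r`-tuple of pairwise commuting `n × n` matrices. For `r = 1`
there is no condition, and one gets the `n`-dimensional representations of the Jordan quiver. -/

/-- `Rep(Q, n, R)` for `Q` the quiver with one vertex and `r` loops and `R` the commutation
relations. -/
abbrev CommTuple (r n : ℕ) : Type :=
  {A : Fin r → Matrix (Fin n) (Fin n) ℂ // ∀ k l, A k * A l = A l * A k}

/-- The coordinate ring of the affine variety of commuting tuples. -/
def tupleCoord (r n : ℕ) : Subalgebra ℂ (CommTuple r n → ℂ) :=
  Algebra.adjoin ℂ {f | ∃ (k : Fin r) (i j : Fin n), f = fun A => A.1 k i j}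

/-- `GL(n, ℂ)` acts on commuting tuples by simultaneous conjugation. -/
def tupleConj (r n : ℕ) (g : GL (Fin n) ℂ) (A : CommTuple r n) : CommTuple r n :=
  ⟨fun k => (g : Matrix (Fin n) (Fin n) ℂ) * A.1 k * ((g⁻¹ : GL (Fin n) ℂ) : Matrix _ _ ℂ), by
    intro k l
    have h : ∀ B C : Matrix (Fin n) (Fin n) ℂ,
        (g : Matrix (Fin n) (Fin n) ℂ) * B * ((g⁻¹ : GL (Fin n) ℂ) : Matrix _ _ ℂ) *
          ((g : Matrix (Fin n) (Fin n) ℂ) * C * ((g⁻¹ : GL (Fin n) ℂ) : Matrix _ _ ℂ)) =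
        (g : Matrix (Fin n) (Fin n) ℂ) * (B * C) * ((g⁻¹ : GL (Fin n) ℂ) : Matrix _ _ ℂ) := by
      intro B C
      simp only [mul_assoc]
      rw [Units.inv_mul_cancel_left]
    rw [h, h, A.2 k l]⟩

/-- The moduli space `M(Q, n, R)` of commuting `r`-tuples of `n × n` matrices;
`quiverModuli 1 n` is `M(Q_J, n) = End(ℂ^n) // GL(n, ℂ)`. -/
def quiverModuli (r n : ℕ) : Over (Spec (CommRingCat.of ℂ)) :=
  gitQuotient (tupleConj r n) (tupleCoord r n)

/-- The closed point `[A]` of `M(Q, n, R)`. -/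
def tuplePoint {r n : ℕ} (A : CommTuple r n) : affOver ℂ ⟶ quiverModuli r n :=
  gitPoint (tupleConj r n) (tupleCoord r n) A

/-- The commuting tuple of the images of the standard generators of `ℤ^r`. -/
def toTuple {r n : ℕ} (ρ : RepSpace r n) : CommTuple r n :=
  ⟨fun k => (ρ (gen k) : Matrix (Fin n) (Fin n) ℂ), by
    intro k l
    rw [← Units.val_mul, ← Units.val_mul, ← map_mul, ← map_mul, mul_comm]⟩

theorem comp_toTuple_mem {r n : ℕ} (f : invariants (tupleConj r n) (tupleCoord r n)) :
    (fun ρ => f.1 (toTuple ρ)) ∈ invariants (repConj r n) (repCoord r n) := by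
  obtain ⟨f, hf, hinv⟩ := f
  refine ⟨?_, fun g ρ => ?_⟩
  · change (fun ρ => f (toTuple ρ)) ∈ repCoord r n
    clear hinv
    change f ∈ Algebra.adjoin ℂ _ at hf
    induction hf using Algebra.adjoin_induction with
    | mem x hx =>
      obtain ⟨k, i, j, rfl⟩ := hx
      exact Algebra.subset_adjoin ⟨gen k, i, j, rfl⟩
    | algebraMap c => exact (repCoord r n).algebraMap_mem c
    | add x y _ _ hx hy => exact (repCoord r n).add_mem hx hy
    | mul x y _ _ hx hy => exact (repCoord r n).mul_mem hx hy
  · exact hinv g (toTuple ρ)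

/-- Restriction of invariant functions along `ρ ↦ (ρ(e₁), …, ρ(e_r))`. -/
def restrictInv (r n : ℕ) :
    invariants (tupleConj r n) (tupleCoord r n) →ₐ[ℂ] invariants (repConj r n) (repCoord r n) where
  toFun f := ⟨fun ρ => f.1 (toTuple ρ), comp_toTuple_mem f⟩
  map_one' := rfl
  map_mul' _ _ := rfl
  map_zero' := rfl
  map_add' _ _ := rfl
  commutes' _ := rfl

/-- The natural morphism `M_r(GL(n, ℂ)) ⟶ M(Q, n, R)`, `[ρ] ↦ [ρ(e₁), …, ρ(e_r)]`. -/
def charToQuiver (r n : ℕ) : charVar r n ⟶ quiverModuli r n :=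
  affMap (restrictInv r n)

/-! ### Tensorization -/

section Tensorization

variable {r : ℕ} {n : Fin r → ℕ} {N : ℕ}

/-- The matrix of `A_1 ⊗ ⋯ ⊗ A_r` on `ℂ^{n_1} ⊗ ⋯ ⊗ ℂ^{n_r}` in the standard basis, enumerated
by `e`; it is multiplicative in `(A_k)_k`. -/
def tensorMatrix (e : (∀ k, Fin (n k)) ≃ Fin N) :
    (∀ k, Matrix (Fin (n k)) (Fin (n k)) ℂ) →* Matrix (Fin N) (Fin N) ℂ where
  toFun A := Matrix.of fun i j => ∏ k, A k (e.symm i k) (e.symm j k)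
  map_one' := by
    ext i j
    simp only [Matrix.of_apply, Pi.one_apply, Matrix.one_apply]
    by_cases h : i = j
    · simp [h]
    · rw [if_neg h]
      obtain ⟨k, hk⟩ : ∃ k, e.symm i k ≠ e.symm j k := by
        by_contra hc
        push Not at hc
        exact h (e.symm.injective (funext hc))
      exact Finset.prod_eq_zero (Finset.mem_univ k) (if_neg hk)
  map_mul' A B := by
    ext i j
    simp only [Matrix.of_apply, Pi.mul_apply, Matrix.mul_apply]
    rw [Fintype.prod_sum (fun k l => A k (e.symm i k) l * B k l (e.symm j k)),
      ← e.symm.sum_comp]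
    exact Finset.sum_congr rfl fun x _ => Finset.prod_mul_distrib

/-- The tensor product of representations of the Jordan quiver: the tuple with `k`-th entry
`1 ⊗ ⋯ ⊗ 1 ⊗ A_k ⊗ 1 ⊗ ⋯ ⊗ 1`. -/
def tensorTuple (e : (∀ k, Fin (n k)) ≃ Fin N) (A : ∀ k, CommTuple 1 (n k)) : CommTuple r N :=
  ⟨fun k => tensorMatrix e (Pi.mulSingle k ((A k).1 0)), by
    intro k l
    rw [← map_mul, ← map_mul]
    by_cases h : k = l
    · subst h; rfl
    · rw [(Pi.mulSingle_commute h _ _).eq]⟩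

/-- The tensor product of representations `ρ_k : ℤ → GL(n_k, ℂ)`: the representation of `ℤ^r`
that sends `a` to `ρ_1(a_1) ⊗ ⋯ ⊗ ρ_r(a_r)`; the `k`-th generator goes to
`1 ⊗ ⋯ ⊗ ρ_k(1) ⊗ ⋯ ⊗ 1`. -/
def tensorRep (e : (∀ k, Fin (n k)) ≃ Fin N) (ρ : ∀ k, RepSpace 1 (n k)) : RepSpace r N :=
  MonoidHom.toHomUnits
    { toFun := fun a => tensorMatrix e fun k =>
        (ρ k (Multiplicative.ofAdd fun _ => Multiplicative.toAdd a k) : Matrix _ _ ℂ)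
      map_one' := by
        rw [← map_one (tensorMatrix e)]
        congr 1
        funext k
        exact congrArg Units.val (map_one (ρ k))
      map_mul' := fun a b => by
        rw [← map_mul]
        congr 1
        funext k
        exact congrArg Units.val (map_mul (ρ k)
          (Multiplicative.ofAdd fun _ => Multiplicative.toAdd a k)
          (Multiplicative.ofAdd fun _ => Multiplicative.toAdd b k)) }

/-- `Φ : M(Q_J, n_1) × ⋯ × M(Q_J, n_r) ⟶ M(Q_J^{⊗ r}, N, R)` is induced by tensorization of quiver
representations: `([A_1], …, [A_r]) ↦ [A_1 ⊗ ⋯ ⊗ A_r]` on closed points. -/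
def IsQuiverTensorization (e : (∀ k, Fin (n k)) ≃ Fin N)
    (Φ : (∏ᶜ fun k => quiverModuli 1 (n k)) ⟶ quiverModuli r N) : Prop :=
  ∀ A : ∀ k, CommTuple 1 (n k),
    Pi.lift (fun k => tuplePoint (A k)) ≫ Φ = tuplePoint (tensorTuple e A)

/-- `F : M_1(GL(n_1)) × ⋯ × M_1(GL(n_r)) ⟶ M_r(GL(N))` is induced by tensorization of
representations: `([ρ_1], …, [ρ_r]) ↦ [ρ_1 ⊗ ⋯ ⊗ ρ_r]` on closed points. -/
def IsCharTensorization (e : (∀ k, Fin (n k)) ≃ Fin N)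
    (F : (∏ᶜ fun k => charVar 1 (n k)) ⟶ charVar r N) : Prop :=
  ∀ ρ : ∀ k, RepSpace 1 (n k),
    Pi.lift (fun k => charPoint (ρ k)) ≫ F = charPoint (tensorRep e ρ)

end Tensorization

/-! ### The explicit rings -/

/-- The representation of `ℤ^r` by diagonal matrices: the `k`-th generator goes to
`diag(t_{k1}, …, t_{kn})`. -/
def diagRep {r n : ℕ} (t : Fin r → Fin n → ℂˣ) : RepSpace r n :=
  MonoidHom.toHomUnits
    { toFun := fun a =>
        Matrix.diagonal fun i => ((∏ k, t k i ^ (Multiplicative.toAdd a k) : ℂˣ) : ℂ)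
      map_one' := by simp
      map_mul' := fun a b => by
        rw [Matrix.diagonal_mul_diagonal]
        congr 1
        funext i
        rw [← Units.val_mul, ← Finset.prod_mul_distrib]
        simp [zpow_add] }

/-- `ℂ[λ^{(k)}_i : 1 ≤ k ≤ r, 1 ≤ i ≤ N]^{𝔖_N}`, where `𝔖_N` permutes the index `i`
simultaneously for all `k`. -/
def multiSym (r N : ℕ) : Subalgebra ℂ (MvPolynomial (Fin r × Fin N) ℂ) where
  carrier := {p | ∀ σ : Equiv.Perm (Fin N), MvPolynomial.rename (Prod.map id σ) p = p}
  mul_mem' := fun ha hb σ => by rw [map_mul, ha σ, hb σ]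
  add_mem' := fun ha hb σ => by rw [map_add, ha σ, hb σ]
  algebraMap_mem' := fun c σ => AlgHom.commutes _ c

/-- The product of all variables `λ^{(k)}_i`. -/
def multiDet (r N : ℕ) : multiSym r N :=
  ⟨∏ k, ∏ i, MvPolynomial.X (k, i), fun σ => by
    simp only [map_prod, MvPolynomial.rename_X, Prod.map_apply, id_eq]
    exact Finset.prod_congr rfl fun k _ =>
      Equiv.prod_comp σ fun i => (MvPolynomial.X (k, i) : MvPolynomial (Fin r × Fin N) ℂ)⟩

/-- `ℂ[λ^{(k)}_i]^{𝔖_N}` localized at the product of all variables. -/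
def MultiSymLoc (r N : ℕ) : Type := Localization.Away (multiDet r N)

instance (r N : ℕ) : CommRing (MultiSymLoc r N) :=
  inferInstanceAs (CommRing (Localization.Away (multiDet r N)))

instance (r N : ℕ) : Algebra (multiSym r N) (MultiSymLoc r N) :=
  inferInstanceAs (Algebra (multiSym r N) (Localization.Away (multiDet r N)))

instance (r N : ℕ) : Algebra ℂ (MultiSymLoc r N) :=
  ((algebraMap (multiSym r N) (MultiSymLoc r N)).comp (algebraMap ℂ (multiSym r N))).toAlgebra

instance (r N : ℕ) : IsScalarTower ℂ (multiSym r N) (MultiSymLoc r N) :=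
  IsScalarTower.of_algebraMap_eq fun _ => rfl

instance (r N : ℕ) : IsLocalization.Away (multiDet r N) (MultiSymLoc r N) :=
  inferInstanceAs (IsLocalization.Away (multiDet r N) (Localization.Away (multiDet r N)))

/-- Evaluation of elements of `MultiSymLoc r N` at an `r`-tuple of points of the torus. -/
def evalMulti {r N : ℕ} (t : Fin r → Fin N → ℂˣ) : MultiSymLoc r N →ₐ[ℂ] ℂ :=
  IsLocalization.liftAlgHom (M := Submonoid.powers (multiDet r N))
    (f := (MvPolynomial.aeval fun x : Fin r × Fin N => (t x.1 x.2 : ℂ)).comp (multiSym r N).val)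
    (by
      rintro ⟨_, m, rfl⟩
      have h : ((MvPolynomial.aeval fun x : Fin r × Fin N => (t x.1 x.2 : ℂ)).comp
          (multiSym r N).val) (multiDet r N) = ((∏ k, ∏ i, t k i : ℂˣ) : ℂ) := by
        simp [multiDet]
      rw [map_pow, h]
      exact (Units.isUnit _).pow m)

section Target

variable {r : ℕ} (n : Fin r → ℕ)

/-- `ℂ[α^{(1)}_1, …, α^{(1)}_{n_1}]^{𝔖_{n_1}} ⊗ ⋯ ⊗ ℂ[α^{(r)}_1, …, α^{(r)}_{n_r}]^{𝔖_{n_r}}`. -/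
abbrev SymTensor : Type := ⨂[ℂ] k, MvPolynomial.symmetricSubalgebra (Fin (n k)) ℂ

/-- The canonical homomorphism from `SymTensor n` to the polynomial ring in all the variables
`α^{(k)}_i`, that sends `p_1 ⊗ ⋯ ⊗ p_r` to `p_1(α^{(1)}) ⋯ p_r(α^{(r)})`. -/
def symTensorToPoly : SymTensor n →ₐ[ℂ] MvPolynomial (Σ k, Fin (n k)) ℂ :=
  PiTensorProduct.liftAlgHom
    ((MultilinearMap.mkPiAlgebra ℂ (Fin r) (MvPolynomial (Σ k, Fin (n k)) ℂ)).compLinearMap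
      fun k => ((MvPolynomial.rename (Sigma.mk k)).comp
        (MvPolynomial.symmetricSubalgebra (Fin (n k)) ℂ).val).toLinearMap)
    (by simp) (by intro x y; simp [Finset.prod_mul_distrib])

/-- The product `α^{(k)}_1 ⋯ α^{(k)}_{n_k}` of the variables, as a symmetric polynomial. -/
def symDet (m : ℕ) : MvPolynomial.symmetricSubalgebra (Fin m) ℂ :=
  ⟨∏ i, MvPolynomial.X i, fun σ => by
    simp only [map_prod, MvPolynomial.rename_X]
    exact Equiv.prod_comp σ fun i => (MvPolynomial.X i : MvPolynomial (Fin m) ℂ)⟩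

/-- The product of all variables `α^{(k)}_i`, as an element of `SymTensor n`. -/
def tensorDet : SymTensor n := PiTensorProduct.tprod ℂ fun k => symDet (n k)

theorem symTensorToPoly_tensorDet :
    symTensorToPoly n (tensorDet n) = ∏ k, ∏ i, MvPolynomial.X ⟨k, i⟩ := by
  simp [symTensorToPoly, tensorDet, symDet]

/-- `SymTensor n` localized at the product of all variables. -/
def SymTensorLoc : Type := Localization.Away (tensorDet n)

instance : CommRing (SymTensorLoc n) :=
  inferInstanceAs (CommRing (Localization.Away (tensorDet n)))

instance : Algebra (SymTensor n) (SymTensorLoc n) :=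
  inferInstanceAs (Algebra (SymTensor n) (Localization.Away (tensorDet n)))

instance : Algebra ℂ (SymTensorLoc n) :=
  ((algebraMap (SymTensor n) (SymTensorLoc n)).comp (algebraMap ℂ (SymTensor n))).toAlgebra

instance : IsScalarTower ℂ (SymTensor n) (SymTensorLoc n) :=
  IsScalarTower.of_algebraMap_eq (R := ℂ) (S := SymTensor n) (A := SymTensorLoc n) fun _ => rfl

instance : IsLocalization.Away (tensorDet n) (SymTensorLoc n) :=
  inferInstanceAs (IsLocalization.Away (tensorDet n) (Localization.Away (tensorDet n)))

variable {n}

/-- Evaluation of elements of `SymTensorLoc n` at a point of the product of the tori. -/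
def evalTensor (s : ∀ k, Fin (n k) → ℂˣ) : SymTensorLoc n →ₐ[ℂ] ℂ :=
  IsLocalization.liftAlgHom (M := Submonoid.powers (tensorDet n))
    (f := (MvPolynomial.aeval fun x : Σ k, Fin (n k) => (s x.1 x.2 : ℂ)).comp (symTensorToPoly n))
    (by
      rintro ⟨_, m, rfl⟩
      have h : ((MvPolynomial.aeval fun x : Σ k, Fin (n k) => (s x.1 x.2 : ℂ)).comp
          (symTensorToPoly n)) (tensorDet n) = ((∏ k, ∏ i, s k i : ℂˣ) : ℂ) := by
        simp [symTensorToPoly_tensorDet]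
      rw [map_pow, h]
      exact (Units.isUnit _).pow m)

/-- `φ` is the substitution homomorphism `p ↦ p(λ^{(k)}_{i} = α^{(k)}_{i_k})`, where the index
`i ∈ {1, …, N}` stands for the multi-index `(i_1, …, i_r)`. -/
def IsSubstitution {N : ℕ} (e : (∀ k, Fin (n k)) ≃ Fin N)
    (φ : multiSym r N →ₐ[ℂ] SymTensor n) : Prop :=
  ∀ p, symTensorToPoly n (φ p) =
    MvPolynomial.rename (fun x : Fin r × Fin N => (⟨x.1, e.symm x.2 x.1⟩ : Σ k, Fin (n k))) p.1

end Target

end SegreChar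

end

noncomputable section

namespace SegreChar

/-! ### Simultaneous triangularization of commuting endomorphisms -/

/-! Everything reduces to diagonal matrices. Commuting complex matrices are simultaneously
triangularizable, and conjugating a lower triangular tuple by `diag(1, s, s², …)` and letting `s →
0` deletes its off-diagonal part (`exists_degenerates_diagTuple`). An invariant polynomial therefore
takes the same value on a tuple and on a diagonal one, so restriction to diagonal tuples embeds the
invariants into the multisymmetric polynomials. It is onto because the symmetrization of a monomial
is the restriction of a mixed discriminant, a conjugation invariant combination of determinants, and
`n!` is invertible (`exists_invariants_equiv_multiSym`). Inverting the product of the determinants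
turns commuting tuples into representations of `ℤ^r` (`isLocalization_detInv`), which gives the open
immersion and the localized rings.

On the source side, the product of the spectra is the spectrum of the tensor product of the rings of
symmetric polynomials. That tensor product is the ring of `∏ 𝔖_{n_k}`-invariants in all the
variables `α`, hence a domain. The substitution lands in it because `∏ 𝔖_{n_k}` acts on
multi-indices through `𝔖_N`.

The morphisms `Φ` and `F` are the spectra of `φ` and its localization. The formula on points holds
for diagonal matrices by evaluation and for all others because degenerations can be tensored
(`Degenerates.tensorTuple`). Uniqueness and compatibility hold because diagonal points separate
functions on the source. Finally, the spectrum of a domain is irreducible, and the scheme-theoretic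
image of `Spec(B → C)` is the spectrum of `B` modulo the kernel (`exists_image_iso`). -/

/-- On a nonzero common invariant subspace of minimal dimension every operator is a scalar: an
eigenspace inside it is again invariant by commutation, hence is everything. -/
theorem exists_common_eigenvector {K V ι : Type*} [Field K] [IsAlgClosed K] [AddCommGroup V]
    [Module K V] [FiniteDimensional K V] [Nontrivial V] (T : ι → Module.End K V)
    (hT : ∀ i j, Commute (T i) (T j)) : ∃ v : V, v ≠ 0 ∧ ∀ i, ∃ c : K, T i v = c • v := by
  let P : ℕ → Prop := fun d => ∃ W : Submodule K V, W ≠ ⊥ ∧ (∀ i, ∀ w ∈ W, T i w ∈ W) ∧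
    Module.finrank K W = d
  have hP : ∃ d, P d := ⟨_, ⊤, top_ne_bot, fun _ _ _ => trivial, rfl⟩
  classical
  obtain ⟨W, hW, hinv, hd⟩ := Nat.find_spec hP
  obtain ⟨v, hv, hv0⟩ := Submodule.exists_mem_ne_zero_of_ne_bot hW
  refine ⟨v, hv0, fun i => ?_⟩
  have : Nontrivial W := ⟨⟨v, hv⟩, 0, fun h => hv0 (congrArg Subtype.val h)⟩
  obtain ⟨c, hc⟩ := Module.End.exists_eigenvalue ((T i).restrict (hinv i))
  obtain ⟨w, hw⟩ := hc.exists_hasEigenvector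
  let U : Submodule K V := W ⊓ Module.End.eigenspace (T i) c
  have hU : U ≠ ⊥ := by
    refine (Submodule.ne_bot_iff _).2 ⟨w, ⟨w.2, ?_⟩, fun h => hw.2 (Subtype.ext h)⟩
    exact Module.End.mem_eigenspace_iff.2 (congrArg Subtype.val hw.apply_eq_smul)
  have hUinv : ∀ j, ∀ u ∈ U, T j u ∈ U := by
    rintro j u ⟨hu, hu'⟩
    refine ⟨hinv j u hu, Module.End.mem_eigenspace_iff.2 ?_⟩
    rw [← Module.End.mul_apply, (hT i j).eq, Module.End.mul_apply,
      Module.End.mem_eigenspace_iff.1 hu', map_smul]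
  have hUW : U = W := Submodule.eq_of_le_of_finrank_le inf_le_left
    (hd ▸ Nat.find_min' hP ⟨U, hU, hUinv, rfl⟩)
  exact ⟨c, Module.End.mem_eigenspace_iff.1 (hUW ▸ hv : v ∈ U).2⟩

/-- Induction on the dimension. A common eigenvector of the transposes is a functional whose kernel
is an invariant hyperplane; a vector outside it goes in front of a triangularizing basis of the
hyperplane. -/
theorem exists_basis_lowerTriangular {K ι : Type*} [Field K] [IsAlgClosed K] (m : ℕ) :
    ∀ {V : Type*} [AddCommGroup V] [Module K V] [FiniteDimensional K V],
      Module.finrank K V = m → ∀ T : ι → Module.End K V, (∀ i j, Commute (T i) (T j)) →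
      ∃ b : Module.Basis (Fin m) K V, ∀ k i j, i < j → b.repr (T k (b j)) i = 0 := by
  induction m with
  | zero =>
    intro V _ _ _ hV T _
    exact ⟨Module.finBasisOfFinrankEq K V hV, fun _ i => i.elim0⟩
  | succ m ih =>
    intro V _ _ _ hV T hT
    have : Nontrivial V := Module.nontrivial_of_finrank_pos (R := K) (by omega)
    obtain ⟨f, hf, hf'⟩ := exists_common_eigenvector (fun i => Module.Dual.transpose (T i))
      (fun i j => by
        ext f v
        exact congrArg f (LinearMap.congr_fun (hT j i).eq v))
    choose c hc using hf'
    have hc' : ∀ i v, f (T i v) = c i * f v := fun i v => LinearMap.congr_fun (hc i) v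
    have hinv : ∀ i, ∀ v ∈ LinearMap.ker f, T i v ∈ LinearMap.ker f := fun i v hv => by
      rw [LinearMap.mem_ker] at hv ⊢
      rw [hc', hv, mul_zero]
    have hfr : Module.finrank K (LinearMap.ker f) = m := by
      have := Module.Dual.finrank_ker_add_one_of_ne_zero hf
      omega
    obtain ⟨b, hb⟩ := ih hfr (fun i => (T i).restrict (hinv i)) (fun i j => by
      ext v
      exact LinearMap.congr_fun (hT i j).eq v.1)
    obtain ⟨y, hy⟩ : ∃ y, f y = 1 := by
      obtain ⟨y, hy⟩ := LinearMap.surjective hf 1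
      exact ⟨y, hy⟩
    have hli : ∀ (c : K), ∀ x ∈ LinearMap.ker f, c • y + x = 0 → c = 0 := by
      intro c x hx h
      have := congrArg f h
      rw [LinearMap.mem_ker] at hx
      simpa [hx, hy] using this
    have hsp : ∀ z : V, ∃ c : K, z + c • y ∈ LinearMap.ker f := fun z =>
      ⟨-f z, by simp [hy]⟩
    let B := Module.Basis.mkFinCons y b hli hsp
    have hB0 : B 0 = y := by simp [B]
    have hBs : ∀ j : Fin m, B j.succ = b j := fun j => by simp [B]
    have key : ∀ x : LinearMap.ker f, B.equivFun x = Fin.cons 0 (b.equivFun x) := by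
      intro x
      apply B.equivFun.symm.injective
      have := congrArg Subtype.val (b.sum_equivFun x)
      simp only [Submodule.coe_sum, Submodule.coe_smul] at this
      rw [LinearEquiv.symm_apply_apply, Module.Basis.equivFun_symm_apply, Fin.sum_univ_succ]
      simpa only [Fin.cons_zero, zero_smul, zero_add, Fin.cons_succ, hBs] using this.symm
    refine ⟨B, fun k i j hij => ?_⟩
    -- As `i < j`, the index `j` is a successor, so `B j` lies in the hyperplane; its image stays
    -- there and has no component along `y`.
    obtain ⟨j, rfl⟩ := Fin.exists_succ_eq.2 (Fin.ne_zero_of_lt hij)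
    have h1 : T k (B j.succ) = ((T k).restrict (hinv k) (b j) : LinearMap.ker f) := by
      rw [hBs]; rfl
    rw [h1, ← Module.Basis.equivFun_apply, key]
    refine Fin.cases (fun _ => ?_) (fun i hij => ?_) i hij
    · simp
    · rw [Fin.cons_succ]
      exact hb k i j (Fin.succ_lt_succ_iff.1 hij)

/-- Commuting matrices over an algebraically closed field are simultaneously triangularizable. -/
theorem exists_conj_lowerTriangular {K ι : Type*} [Field K] [IsAlgClosed K] {m : ℕ}
    (A : ι → Matrix (Fin m) (Fin m) K) (hA : ∀ i j, Commute (A i) (A j)) :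
    ∃ g : GL (Fin m) K, ∀ k, ∀ i j : Fin m, i < j →
      ((g : Matrix (Fin m) (Fin m) K) * A k *
        ((g⁻¹ : GL (Fin m) K) : Matrix (Fin m) (Fin m) K) : Matrix (Fin m) (Fin m) K) i j = 0 := by
  obtain ⟨b, hb⟩ := exists_basis_lowerTriangular m (V := Fin m → K) (by simp)
    (fun k => Matrix.toLin' (A k)) (fun i j => by
      rw [commute_iff_eq, Module.End.mul_eq_comp, Module.End.mul_eq_comp, ← Matrix.toLin'_mul,
        ← Matrix.toLin'_mul, (hA i j).eq])
  let p := b.toMatrix (Pi.basisFun K (Fin m))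
  let q := (Pi.basisFun K (Fin m)).toMatrix b
  refine ⟨⟨p, q, Module.Basis.toMatrix_mul_toMatrix_flip _ _,
    Module.Basis.toMatrix_mul_toMatrix_flip _ _⟩, fun k i j hij => ?_⟩
  have : p * A k * q = LinearMap.toMatrix b b (Matrix.toLin' (A k)) := by
    rw [← basis_toMatrix_mul_linearMap_toMatrix_mul_basis_toMatrix b (Pi.basisFun K (Fin m)) b
      (Pi.basisFun K (Fin m)) (Matrix.toLin' (A k))]
    congr 2
    exact (LinearMap.toMatrix'_toLin' (A k)).symm
  change (p * A k * q) i j = 0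
  rw [this, LinearMap.toMatrix_apply]
  exact hb k i j hij

/-! ### Degeneration of commuting tuples to diagonal tuples -/

/-- The commuting tuple of the diagonal matrices `diag(t_{k1}, …, t_{kn})`. -/
def diagTuple {r n : ℕ} (t : Fin r → Fin n → ℂ) : CommTuple r n :=
  ⟨fun k => Matrix.diagonal (t k), fun k l => by
    rw [Matrix.diagonal_mul_diagonal, Matrix.diagonal_mul_diagonal]
    simp only [mul_comm]⟩

/-- `B` is a limit point of a curve inside the orbit of `A`. -/
def Degenerates {r n : ℕ} (A B : CommTuple r n) : Prop :=
  ∃ W : ℂ → CommTuple r n, (∀ k, Continuous fun s => (W s).1 k) ∧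
    (∀ s ≠ 0, ∃ g, W s = tupleConj r n g A) ∧ W 0 = B

theorem continuous_of_mem_tupleCoord {r n : ℕ} {f : CommTuple r n → ℂ} (hf : f ∈ tupleCoord r n)
    {W : ℂ → CommTuple r n} (hW : ∀ k, Continuous fun s => (W s).1 k) :
    Continuous fun s => f (W s) := by
  induction hf using Algebra.adjoin_induction with
  | mem x hx =>
    obtain ⟨k, i, j, rfl⟩ := hx
    exact (hW k).matrix_elem i j
  | algebraMap c => exact continuous_const
  | add x y _ _ hx hy => exact hx.add hy
  | mul x y _ _ hx hy => exact hx.mul hy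

/-- An invariant is constant along the curve away from `0`, and the punctured line is dense. -/
theorem Degenerates.eval_eq {r n : ℕ} {A B : CommTuple r n} (h : Degenerates A B)
    (f : invariants (tupleConj r n) (tupleCoord r n)) : f.1 A = f.1 B := by
  obtain ⟨W, hW, hconj, rfl⟩ := h
  have hcont := continuous_of_mem_tupleCoord f.2.1 hW
  have hconst : Set.EqOn (fun s => f.1 (W s)) (fun _ => f.1 A) {0}ᶜ := by
    intro s hs
    obtain ⟨g, hg⟩ := hconj s hs
    simp only [hg, f.2.2 g A]
  exact (congrFun (hcont.ext_on (dense_compl_singleton (0 : ℂ)) continuous_const hconst) 0).symm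

theorem tupleConj_mul {r n : ℕ} (g h : GL (Fin n) ℂ) (A : CommTuple r n) :
    tupleConj r n (g * h) A = tupleConj r n g (tupleConj r n h A) := by
  apply Subtype.ext
  funext k
  simp [tupleConj, mul_assoc]

theorem exists_degenerates_diagTuple {r n : ℕ} (A : CommTuple r n) :
    ∃ t, Degenerates A (diagTuple t) := by
  obtain ⟨g, hg⟩ := exists_conj_lowerTriangular A.1 A.2
  let L := tupleConj r n g A
  have hL : ∀ k i j, i < j → L.1 k i j = 0 := hg
  -- This is conjugation by `diag(s^i)`, extended to `s = 0`. Truncated subtraction is harmless: for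
  -- `i < j` the entry of `L` vanishes.
  let w : ℂ → Fin r → Matrix (Fin n) (Fin n) ℂ := fun s k =>
    Matrix.of fun i j => s ^ (i.1 - j.1) * L.1 k i j
  let D : ∀ s : ℂ, s ≠ 0 → GL (Fin n) ℂ := fun s hs =>
    Units.map (Matrix.diagonalRingHom (Fin n) ℂ).toMonoidHom
      (MulEquiv.piUnits.symm fun i => Units.mk0 s hs ^ i.1)
  have hw : ∀ s (hs : s ≠ 0), w s = (tupleConj r n (D s hs) L).1 := by
    intro s hs
    funext k
    ext i j
    have : (tupleConj r n (D s hs) L).1 k = Matrix.diagonal (fun i : Fin n => s ^ i.1) * L.1 k *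
        Matrix.diagonal (fun i : Fin n => (s ^ i.1)⁻¹) := by
      simp only [tupleConj]
      congr 2
      simp [D, ← map_inv, Matrix.diagonal]
    rw [this, Matrix.mul_diagonal, Matrix.diagonal_mul]
    simp only [w, Matrix.of_apply]
    rcases lt_or_ge i j with h | h
    · simp [hL k i j h]
    · have h' : j.1 ≤ i.1 := h
      rw [pow_sub₀ s hs h']
      ring
  have hw0 : w 0 = fun k => Matrix.diagonal fun i => L.1 k i i := by
    funext k
    ext i j
    simp only [w, Matrix.of_apply, Matrix.diagonal_apply]
    rcases lt_trichotomy i j with h | h | h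
    · simp [hL k i j h, h.ne]
    · simp [h]
    · have : i.1 - j.1 ≠ 0 := by have : j.1 < i.1 := h; omega
      simp [this, h.ne']
  -- Away from `0` the tuple is a conjugate of `L`; at `0` it is diagonal.
  have hcomm : ∀ s k l, w s k * w s l = w s l * w s k := by
    intro s
    by_cases hs : s = 0
    · subst hs
      rw [hw0]
      exact (diagTuple fun k i => L.1 k i i).2
    · rw [hw s hs]
      exact (tupleConj r n (D s hs) L).2
  refine ⟨fun k i => L.1 k i i, fun s => ⟨w s, hcomm s⟩, fun k => ?_, fun s hs => ?_, ?_⟩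
  · exact continuous_matrix fun i j => by
      simp only [w, Matrix.of_apply]
      fun_prop
  · exact ⟨D s hs * g, Subtype.ext (by rw [tupleConj_mul]; exact hw s hs)⟩
  · exact Subtype.ext hw0

/-! ### Tensor products of degenerations -/

section Tensor

variable {r : ℕ} {n : Fin r → ℕ} {N : ℕ} (e : (∀ k, Fin (n k)) ≃ Fin N)

/-- The conjugating element is `g_1 ⊗ ⋯ ⊗ g_r`; in the slots that hold the identity it cancels. -/
theorem tensorTuple_conj (g : ∀ k, GL (Fin (n k)) ℂ) (A : ∀ k, CommTuple 1 (n k)) :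
    tensorTuple e (fun k => tupleConj 1 (n k) (g k) (A k)) =
      tupleConj r N (Units.map (tensorMatrix e) (MulEquiv.piUnits.symm g)) (tensorTuple e A) := by
  apply Subtype.ext
  funext k
  simp only [tensorTuple, tupleConj]
  rw [← map_inv, Units.coe_map, Units.coe_map, ← map_mul, ← map_mul]
  congr 1
  funext l
  by_cases h : l = k
  · subst h
    simp
  · simp [Pi.mulSingle_eq_of_ne h]

theorem tensorTuple_diagTuple (t : ∀ k, Fin (n k) → ℂ) :
    tensorTuple e (fun k => diagTuple fun _ => t k) =
      diagTuple fun k i => t k (e.symm i k) := by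
  apply Subtype.ext
  funext k
  ext i j
  simp only [tensorTuple, diagTuple, tensorMatrix, MonoidHom.coe_mk, OneHom.coe_mk,
    Matrix.of_apply, Matrix.diagonal_apply]
  by_cases h : i = j
  · subst h
    rw [Finset.prod_eq_single k, if_pos rfl]
    · simp
    · intro l _ hl
      simp [Pi.mulSingle_eq_of_ne hl]
    · simp
  · rw [if_neg h]
    obtain ⟨l, hl⟩ : ∃ l, e.symm i l ≠ e.symm j l := by
      by_contra hc
      push Not at hc
      exact h (e.symm.injective (funext hc))
    apply Finset.prod_eq_zero (Finset.mem_univ l)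
    by_cases hlk : l = k
    · subst hlk
      simp [hl]
    · simp [Pi.mulSingle_eq_of_ne hlk, hl]

theorem Degenerates.tensorTuple {A B : ∀ k, CommTuple 1 (n k)}
    (h : ∀ k, Degenerates (A k) (B k)) :
    Degenerates (tensorTuple e A) (tensorTuple e B) := by
  choose W hW hconj h0 using h
  refine ⟨fun s => SegreChar.tensorTuple e fun k => W k s, fun k => ?_, fun s hs => ?_, ?_⟩
  · refine continuous_matrix fun i j => ?_
    simp only [SegreChar.tensorTuple, tensorMatrix, MonoidHom.coe_mk, OneHom.coe_mk,
      Matrix.of_apply]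
    refine continuous_finsetProd _ fun l _ => ?_
    by_cases hlk : l = k
    · subst hlk
      simpa using (hW l 0).matrix_elem _ _
    · simp only [Pi.mulSingle_eq_of_ne hlk]
      exact continuous_const
  · choose g hg using fun k => hconj k s hs
    exact ⟨_, by rw [← tensorTuple_conj e g A]; simp only [hg]⟩
  · simp only [h0]

end Tensor

/-! ### Multisymmetric polynomials as invariants of commuting tuples -/

/-- Ryser's formula for the permanent. -/
theorem sum_neg_one_pow_mul_prod_sum_compl {ι R : Type*} [Fintype ι] [DecidableEq ι] [CommRing R]
    (x : ι → ι → R) :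
    ∑ U : Finset ι, (-1 : R) ^ U.card * ∏ j, ∑ i ∈ Uᶜ, x i j =
      ∑ σ : Equiv.Perm ι, ∏ j, x (σ j) j := by
  -- Expand the product of sums over maps `f`; the term of `f` occurs for `U` exactly when `U`
  -- misses the image of `f`.
  have h1 : ∀ U : Finset ι, (-1 : R) ^ U.card * ∏ j, ∑ i ∈ Uᶜ, x i j =
      ∑ f : ι → ι, (∏ j, x (f j) j) *
        if U ⊆ (Finset.univ.image f)ᶜ then (-1 : R) ^ U.card else 0 := by
    intro U
    rw [Finset.prod_univ_sum, Finset.mul_sum]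
    simp only [mul_ite, mul_zero]
    rw [← Finset.sum_filter]
    refine Finset.sum_congr ?_ fun f _ => mul_comm _ _
    ext f
    simp only [Fintype.mem_piFinset, Finset.mem_compl, Finset.mem_filter, Finset.mem_univ,
      true_and, Finset.subset_iff, Finset.mem_image, not_exists]
    exact ⟨fun h u hu j hj => h j (hj ▸ hu), fun h j hj => h hj j rfl⟩
  -- The alternating sum over subsets of the complement of the image is zero unless that complement
  -- is empty, so only bijections survive.
  have h2 : ∀ f : ι → ι, (∑ U : Finset ι,
      if U ⊆ (Finset.univ.image f)ᶜ then (-1 : R) ^ U.card else 0) =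
        if Function.Bijective f then 1 else 0 := by
    intro f
    rw [← Finset.sum_filter]
    have h3 : (Finset.univ.filter fun U : Finset ι => U ⊆ (Finset.univ.image f)ᶜ) =
        ((Finset.univ.image f)ᶜ).powerset := by
      ext; simp
    have h4 := congrArg (Int.cast : ℤ → R)
      (Finset.sum_powerset_neg_one_pow_card (x := (Finset.univ.image f)ᶜ))
    push_cast at h4
    rw [h3, h4]
    refine if_congr ?_ rfl rfl
    rw [Finset.compl_eq_empty_iff, ← Finset.coe_eq_univ, Finset.coe_image, Finset.coe_univ,
      Set.image_univ, Set.range_eq_univ, Finite.surjective_iff_bijective]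
  simp only [h1]
  rw [Finset.sum_comm]
  simp only [← Finset.mul_sum, h2]
  simp only [mul_ite, mul_one, mul_zero]
  rw [← Finset.sum_filter]
  refine Finset.sum_bij (fun f hf => Equiv.ofBijective f (Finset.mem_filter.1 hf).2)
    (fun _ _ => Finset.mem_univ _) (fun f _ g _ h => congrArg (fun σ : Equiv.Perm ι => ⇑σ) h)
    (fun σ _ => ⟨σ, by simp, Equiv.ext fun _ => rfl⟩) (fun _ _ => rfl)

/-- The matrix of coordinate functions of the `k`-th entry of a commuting tuple. -/
def genericMatrix (r n : ℕ) (k : Fin r) : Matrix (Fin n) (Fin n) (tupleCoord r n) :=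
  Matrix.of fun i j => ⟨fun A => A.1 k i j, Algebra.subset_adjoin ⟨k, i, j, rfl⟩⟩

/-- Evaluation of regular functions at a commuting tuple. -/
def evalTuple {r n : ℕ} (A : CommTuple r n) : tupleCoord r n →ₐ[ℂ] ℂ :=
  (Pi.evalAlgHom ℂ (fun _ : CommTuple r n => ℂ) A).comp (tupleCoord r n).val

theorem evalTuple_apply {r n : ℕ} (A : CommTuple r n) (f : tupleCoord r n) :
    evalTuple A f = f.1 A := rfl

theorem mapMatrix_genericMatrix {r n : ℕ} (A : CommTuple r n) (k : Fin r) :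
    (evalTuple A).mapMatrix (genericMatrix r n k) = A.1 k := rfl

/-- The monomial with exponents `a` in the entries of a tuple. -/
def monomialIn {r : ℕ} {M : Type*} [Monoid M] (a : Fin r → ℕ) (x : Fin r → M) : M :=
  ((List.finRange r).map fun k => x k ^ a k).prod

theorem map_monomialIn {r : ℕ} {M M' F : Type*} [Monoid M] [Monoid M'] [FunLike F M M']
    [MonoidHomClass F M M'] (φ : F) (a : Fin r → ℕ) (x : Fin r → M) :
    φ (monomialIn a x) = monomialIn a fun k => φ (x k) := by
  simp [monomialIn, map_list_prod, Function.comp_def]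

theorem monomialIn_eq_prod {r : ℕ} {M : Type*} [CommMonoid M] (a : Fin r → ℕ) (x : Fin r → M) :
    monomialIn a x = ∏ k, x k ^ a k :=
  (Fin.prod_univ_def _).symm

/-- The mixed discriminant of `n` monomials in the entries of a commuting tuple. -/
def mixedDisc {r n : ℕ} (a : Fin n → Fin r → ℕ) : tupleCoord r n :=
  ∑ U : Finset (Fin n), (-1) ^ U.card *
    (∑ i ∈ Uᶜ, monomialIn (a i) (genericMatrix r n)).det

theorem mixedDisc_apply {r n : ℕ} (a : Fin n → Fin r → ℕ) (A : CommTuple r n) :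
    (mixedDisc a).1 A = ∑ U : Finset (Fin n), (-1) ^ U.card *
      (∑ i ∈ Uᶜ, monomialIn (a i) A.1).det := by
  rw [← evalTuple_apply, mixedDisc]
  simp only [map_sum, map_mul, map_pow, map_neg, map_one, AlgHom.map_det, map_monomialIn,
    mapMatrix_genericMatrix]

theorem mixedDisc_tupleConj {r n : ℕ} (a : Fin n → Fin r → ℕ) (g : GL (Fin n) ℂ)
    (A : CommTuple r n) : (mixedDisc a).1 (tupleConj r n g A) = (mixedDisc a).1 A := by
  rw [mixedDisc_apply, mixedDisc_apply]
  refine Finset.sum_congr rfl fun U _ => ?_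
  congr 1
  -- Conjugation is a ring automorphism, so it passes through monomials and sums, and the
  -- determinant does not see it.
  let φ := MulSemiringAction.toRingHom (ConjAct (GL (Fin n) ℂ)) (Matrix (Fin n) (Fin n) ℂ)
    (ConjAct.toConjAct g)
  have h : (tupleConj r n g A).1 = fun k => φ (A.1 k) := rfl
  simp only [h, ← map_monomialIn, ← map_sum]
  exact Matrix.det_units_conj g _

/-- For diagonal matrices each determinant is a product of sums, so the alternating sum is a
permanent by Ryser's formula. -/
theorem mixedDisc_diagTuple {r n : ℕ} (a : Fin n → Fin r → ℕ) (t : Fin r → Fin n → ℂ) :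
    (mixedDisc a).1 (diagTuple t) = ∑ σ : Equiv.Perm (Fin n), ∏ i, ∏ k, t k (σ i) ^ a i k := by
  have h : (diagTuple t).1 = fun k => Matrix.diagonalRingHom (Fin n) ℂ (t k) := rfl
  rw [mixedDisc_apply]
  simp only [h, ← map_monomialIn, ← map_sum]
  simp only [Matrix.diagonalRingHom_apply, Matrix.det_diagonal, Finset.sum_apply,
    monomialIn_eq_prod, Finset.prod_apply, Pi.pow_apply]
  rw [sum_neg_one_pow_mul_prod_sum_compl fun i j => ∏ k, t k j ^ a i k,
    ← Equiv.sum_comp (Equiv.inv _)]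
  refine Finset.sum_congr rfl fun σ _ => ?_
  rw [← Equiv.prod_comp σ]
  simp

/-- A monomial in the variables `(k, i)` is a product over `i` of monomials in the `i`-th diagonal
entries of the tuple. The mixed discriminant of these `n` monomials restricts to its symmetrization.
-/
theorem exists_invariant_eq_sum_rename {r n : ℕ} (p : MvPolynomial (Fin r × Fin n) ℂ) :
    ∃ f : invariants (tupleConj r n) (tupleCoord r n), ∀ t : Fin r → Fin n → ℂ,
      f.1 (diagTuple t) = ∑ σ : Equiv.Perm (Fin n),
        MvPolynomial.aeval (fun x => t x.1 x.2) (MvPolynomial.rename (Prod.map id σ) p) := by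
  induction p using MvPolynomial.induction_on' with
  | monomial m c =>
    let a : Fin n → Fin r → ℕ := fun i k => m (k, i)
    refine ⟨c • ⟨(mixedDisc a).1, (mixedDisc a).2, mixedDisc_tupleConj a⟩, fun t => ?_⟩
    change c * (mixedDisc a).1 (diagTuple t) = _
    rw [mixedDisc_diagTuple, Finset.mul_sum]
    refine Finset.sum_congr rfl fun σ _ => ?_
    rw [MvPolynomial.aeval_rename, MvPolynomial.aeval_monomial,
      Finsupp.prod_fintype _ _ (fun _ => pow_zero _), Fintype.prod_prod_type, Finset.prod_comm]
    rfl
  | add p q hp hq =>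
    obtain ⟨f, hf⟩ := hp
    obtain ⟨g, hg⟩ := hq
    refine ⟨f + g, fun t => ?_⟩
    change f.1 _ + g.1 _ = _
    simp only [hf, hg, map_add, Finset.sum_add_distrib]

theorem exists_poly_of_mem_tupleCoord {r n : ℕ} {f : CommTuple r n → ℂ}
    (hf : f ∈ tupleCoord r n) : ∃ p : MvPolynomial (Fin r × Fin n) ℂ,
      ∀ t : Fin r → Fin n → ℂ, MvPolynomial.aeval (fun x => t x.1 x.2) p = f (diagTuple t) := by
  induction hf using Algebra.adjoin_induction with
  | mem x hx =>
    obtain ⟨k, i, j, rfl⟩ := hx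
    by_cases h : i = j
    · exact ⟨MvPolynomial.X (k, i), fun t => by simp [diagTuple, h]⟩
    · exact ⟨0, fun t => by simp [diagTuple, h]⟩
  | algebraMap c => exact ⟨MvPolynomial.C c, fun t => by simp⟩
  | add x y _ _ hx hy =>
    obtain ⟨p, hp⟩ := hx
    obtain ⟨q, hq⟩ := hy
    exact ⟨p + q, fun t => by rw [map_add, hp, hq]; rfl⟩
  | mul x y _ _ hx hy =>
    obtain ⟨p, hp⟩ := hx
    obtain ⟨q, hq⟩ := hy
    exact ⟨p * q, fun t => by rw [map_mul, hp, hq]; rfl⟩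

theorem exists_tupleConj_diagTuple_perm {r n : ℕ} (σ : Equiv.Perm (Fin n))
    (t : Fin r → Fin n → ℂ) :
    ∃ g, tupleConj r n g (diagTuple t) = diagTuple fun k i => t k (σ i) := by
  have h : ∀ τ : Equiv.Perm (Fin n), (τ.toPEquiv.toMatrix : Matrix _ _ ℂ) *
      τ.symm.toPEquiv.toMatrix = 1 := fun τ => by
    rw [← PEquiv.toMatrix_trans, ← Equiv.toPEquiv_trans]
    simp
  refine ⟨⟨σ.toPEquiv.toMatrix, σ.symm.toPEquiv.toMatrix, h σ, h σ.symm⟩, Subtype.ext ?_⟩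
  funext k
  change (σ.toPEquiv.toMatrix : Matrix (Fin n) (Fin n) ℂ) * Matrix.diagonal (t k) *
    σ.symm.toPEquiv.toMatrix = Matrix.diagonal fun i => t k (σ i)
  rw [PEquiv.toMatrix_toPEquiv_mul, PEquiv.mul_toMatrix_toPEquiv, Matrix.submatrix_submatrix]
  exact Matrix.submatrix_diagonal_equiv (t k) σ

theorem aeval_injective {r n : ℕ} {p q : MvPolynomial (Fin r × Fin n) ℂ}
    (h : ∀ t : Fin r → Fin n → ℂ, MvPolynomial.aeval (fun x => t x.1 x.2) p =
      MvPolynomial.aeval (fun x => t x.1 x.2) q) : p = q :=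
  MvPolynomial.funext fun x => by
    simpa [MvPolynomial.aeval_eq_eval] using h fun k i => x (k, i)

/-- Restriction to diagonal tuples identifies the invariants of commuting tuples with the
multisymmetric polynomials. -/
theorem exists_invariants_equiv_multiSym (r n : ℕ) :
    ∃ E : invariants (tupleConj r n) (tupleCoord r n) ≃ₐ[ℂ] multiSym r n,
      ∀ f (t : Fin r → Fin n → ℂ),
        MvPolynomial.aeval (fun x => t x.1 x.2) (E f).1 = f.1 (diagTuple t) := by
  choose P hP using fun f : invariants (tupleConj r n) (tupleCoord r n) =>
    exists_poly_of_mem_tupleCoord f.2.1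
  have hmem : ∀ f, P f ∈ multiSym r n := fun f σ => aeval_injective fun t => by
    obtain ⟨g, hg⟩ := exists_tupleConj_diagTuple_perm σ t
    rw [MvPolynomial.aeval_rename, hP f, ← f.2.2 g, hg]
    exact hP f fun k i => t k (σ i)
  let E : invariants (tupleConj r n) (tupleCoord r n) →ₐ[ℂ] multiSym r n :=
    { toFun := fun f => ⟨P f, hmem f⟩
      map_one' := Subtype.ext (aeval_injective fun t => by simp [hP])
      map_mul' := fun f g => Subtype.ext (aeval_injective fun t => by
        change _ = MvPolynomial.aeval _ (P f * P g)
        rw [hP, map_mul, hP, hP]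
        rfl)
      map_zero' := Subtype.ext (aeval_injective fun t => by simp [hP])
      map_add' := fun f g => Subtype.ext (aeval_injective fun t => by
        change _ = MvPolynomial.aeval _ (P f + P g)
        rw [hP, map_add, hP, hP]
        rfl)
      commutes' := fun c => Subtype.ext (aeval_injective fun t => by simp [hP]) }
  refine ⟨AlgEquiv.ofBijective E ⟨fun f g h => Subtype.ext (funext fun A => ?_), fun p => ?_⟩,
    fun f t => hP f t⟩
  -- Injectivity: the value of an invariant at `A` is its value at a diagonal degeneration.
  · obtain ⟨t, ht⟩ := exists_degenerates_diagTuple A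
    have h' : P f = P g := congrArg Subtype.val h
    rw [ht.eval_eq, ht.eval_eq, ← hP, ← hP, h']
  -- Surjectivity: symmetrizing a multisymmetric polynomial multiplies it by `n!`.
  · obtain ⟨f, hf⟩ := exists_invariant_eq_sum_rename p.1
    refine ⟨((n.factorial : ℂ)⁻¹) • f, Subtype.ext (aeval_injective fun t => ?_)⟩
    refine (hP _ t).trans ?_
    change (n.factorial : ℂ)⁻¹ * f.1 (diagTuple t) = _
    rw [hf, Finset.sum_congr rfl fun σ _ => by rw [p.2 σ], Finset.sum_const, Finset.card_univ,
      Fintype.card_perm, Fintype.card_fin, nsmul_eq_mul,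
      inv_mul_cancel_left₀ (Nat.cast_ne_zero.2 n.factorial_ne_zero)]

/-- The multisymmetric polynomials in one family of variables are the symmetric polynomials. -/
def multiSymOneEquiv (m : ℕ) : multiSym 1 m ≃ₐ[ℂ] MvPolynomial.symmetricSubalgebra (Fin m) ℂ :=
  have h : ∀ σ : Equiv.Perm (Fin m), σ ∘ Prod.snd = Prod.snd ∘ Prod.map (id : Fin 1 → Fin 1) σ :=
    fun _ => rfl
  have h' : ∀ σ : Equiv.Perm (Fin m),
      Prod.map (id : Fin 1 → Fin 1) σ ∘ Prod.mk 0 = Prod.mk 0 ∘ σ := fun _ => rfl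
  have h₁ : Prod.snd ∘ Prod.mk (0 : Fin 1) = (id : Fin m → Fin m) := rfl
  have h₂ : Prod.mk (0 : Fin 1) ∘ Prod.snd = (id : Fin 1 × Fin m → _) :=
    funext fun x => Prod.ext (Subsingleton.elim _ _) rfl
  AlgEquiv.ofAlgHom
    (((MvPolynomial.rename Prod.snd).comp (multiSym 1 m).val).codRestrict _ fun p σ => by
      change MvPolynomial.rename σ (MvPolynomial.rename Prod.snd p.1) =
        MvPolynomial.rename Prod.snd p.1
      rw [MvPolynomial.rename_rename, h, ← MvPolynomial.rename_rename, p.2 σ])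
    (((MvPolynomial.rename (Prod.mk 0)).comp
      (MvPolynomial.symmetricSubalgebra (Fin m) ℂ).val).codRestrict _ fun p σ => by
      change MvPolynomial.rename _ (MvPolynomial.rename (Prod.mk 0) p.1) =
        MvPolynomial.rename (Prod.mk 0) p.1
      rw [MvPolynomial.rename_rename, h', ← MvPolynomial.rename_rename, p.2 σ])
    (AlgHom.ext fun p => Subtype.ext (by
      change MvPolynomial.rename Prod.snd (MvPolynomial.rename (Prod.mk 0) p.1) = p.1
      rw [MvPolynomial.rename_rename, h₁, MvPolynomial.rename_id_apply]))
    (AlgHom.ext fun p => Subtype.ext (by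
      change MvPolynomial.rename (Prod.mk 0) (MvPolynomial.rename Prod.snd p.1) = p.1
      rw [MvPolynomial.rename_rename, h₂, MvPolynomial.rename_id_apply]))

theorem exists_invariants_equiv_symmetric (m : ℕ) :
    ∃ E : invariants (tupleConj 1 m) (tupleCoord 1 m) ≃ₐ[ℂ]
        MvPolynomial.symmetricSubalgebra (Fin m) ℂ,
      ∀ f (t : Fin m → ℂ), MvPolynomial.aeval t (E f).1 = f.1 (diagTuple fun _ => t) := by
  obtain ⟨E, hE⟩ := exists_invariants_equiv_multiSym 1 m
  refine ⟨E.trans (multiSymOneEquiv m), fun f t => ?_⟩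
  rw [← hE]
  exact MvPolynomial.aeval_rename Prod.snd t (E f).1

/-! ### The tensor product of the rings of symmetric polynomials -/

section

variable {r : ℕ} (n : Fin r → ℕ)

theorem symTensorToPoly_tprod (p : ∀ k, MvPolynomial.symmetricSubalgebra (Fin (n k)) ℂ) :
    symTensorToPoly n (PiTensorProduct.tprod ℂ p) =
      ∏ k, MvPolynomial.rename (Sigma.mk k) (p k).1 := by
  simp [symTensorToPoly]

theorem symTensorToPoly_singleAlgHom (k : Fin r)
    (p : MvPolynomial.symmetricSubalgebra (Fin (n k)) ℂ) :
    symTensorToPoly n (PiTensorProduct.singleAlgHom k p) =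
      MvPolynomial.rename (Sigma.mk k) p.1 := by
  rw [PiTensorProduct.singleAlgHom_apply, symTensorToPoly_tprod, Finset.prod_eq_single k]
  · simp
  · intro l _ hl
    simp [Pi.mulSingle_eq_of_ne hl]
  · simp

/-- Over a field each inclusion of symmetric polynomials has a linear retraction. The tensor product
of these retractions, applied after splitting a polynomial into its blocks of variables, is a left
inverse. -/
theorem symTensorToPoly_injective : Function.Injective (symTensorToPoly n) := by
  choose π hπ using fun k => LinearMap.exists_leftInverse_of_injective
    (MvPolynomial.symmetricSubalgebra (Fin (n k)) ℂ).val.toLinearMap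
    (LinearMap.ker_eq_bot.2 Subtype.val_injective)
  let ψ : MvPolynomial (Σ k, Fin (n k)) ℂ →ₐ[ℂ] ⨂[ℂ] k, MvPolynomial (Fin (n k)) ℂ :=
    MvPolynomial.aeval fun x => PiTensorProduct.singleAlgHom x.1 (MvPolynomial.X x.2)
  have hψ : ∀ k (q : MvPolynomial (Fin (n k)) ℂ),
      ψ (MvPolynomial.rename (Sigma.mk k) q) = PiTensorProduct.singleAlgHom k q := by
    intro k
    have : ψ.comp (MvPolynomial.rename (Sigma.mk k)) =
        PiTensorProduct.singleAlgHom (R := ℂ) (A := fun k => MvPolynomial (Fin (n k)) ℂ) k :=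
      MvPolynomial.algHom_ext fun i => by simp [ψ]
    exact DFunLike.congr_fun this
  have hcomp : (PiTensorProduct.map π) ∘ₗ ψ.toLinearMap ∘ₗ (symTensorToPoly n).toLinearMap =
      LinearMap.id := by
    refine PiTensorProduct.ext (MultilinearMap.ext fun p => ?_)
    change PiTensorProduct.map π (ψ (symTensorToPoly n (PiTensorProduct.tprod ℂ p))) =
      PiTensorProduct.tprod ℂ p
    rw [symTensorToPoly_tprod, map_prod]
    simp only [hψ, PiTensorProduct.singleAlgHom_apply, MonoidHom.mulSingle_apply]
    rw [← PiTensorProduct.tprod_prod, Finset.univ_prod_mulSingle, PiTensorProduct.map_tprod]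
    congr 1
    funext k
    exact LinearMap.congr_fun (hπ k) (p k)
  exact Function.LeftInverse.injective (g := fun y => PiTensorProduct.map π (ψ y))
    (LinearMap.congr_fun hcomp)

/-- The action of `∏ 𝔖_{n_k}` on the polynomials in the variables `α^{(k)}_i`. -/
def blockRename (σ : ∀ k, Equiv.Perm (Fin (n k))) :
    MvPolynomial (Σ k, Fin (n k)) ℂ →ₐ[ℂ] MvPolynomial (Σ k, Fin (n k)) ℂ :=
  MvPolynomial.rename (Sigma.map id fun k => σ k)

theorem exists_symTensorToPoly_eq_sum (p : MvPolynomial (Σ k, Fin (n k)) ℂ) :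
    ∃ x, symTensorToPoly n x = ∑ σ : ∀ k, Equiv.Perm (Fin (n k)), blockRename n σ p := by
  induction p using MvPolynomial.induction_on' with
  | monomial m c =>
    let q : ∀ k, MvPolynomial (Fin (n k)) ℂ := fun k => ∏ i, MvPolynomial.X i ^ m ⟨k, i⟩
    have hsymm : ∀ k, (∑ σ : Equiv.Perm (Fin (n k)), MvPolynomial.rename σ (q k)) ∈
        MvPolynomial.symmetricSubalgebra (Fin (n k)) ℂ := fun k τ => by
      rw [map_sum, ← Equiv.sum_comp (Equiv.mulLeft τ) fun σ => MvPolynomial.rename σ (q k)]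
      exact Finset.sum_congr rfl fun σ _ => MvPolynomial.rename_rename _ _ _
    refine ⟨c • PiTensorProduct.tprod ℂ fun k => ⟨_, hsymm k⟩, ?_⟩
    have hm : MvPolynomial.monomial m c =
        c • ∏ k, MvPolynomial.rename (Sigma.mk k) (q k) := by
      rw [MvPolynomial.monomial_eq, Finsupp.prod_fintype _ _ (fun _ => pow_zero _),
        Fintype.prod_sigma, MvPolynomial.smul_eq_C_mul]
      simp [q]
    rw [map_smul, symTensorToPoly_tprod, hm]
    simp only [map_sum, map_smul, ← Finset.smul_sum]
    -- A product of symmetrizations over the `𝔖_{n_k}` expands to the symmetrization over their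
    -- product.
    rw [Fintype.prod_sum]
    simp only [map_prod, blockRename, MvPolynomial.rename_rename]
    rfl
  | add p q hp hq =>
    obtain ⟨x, hx⟩ := hp
    obtain ⟨y, hy⟩ := hq
    exact ⟨x + y, by simp only [map_add, hx, hy, Finset.sum_add_distrib]⟩

/-- Averaging over the finite group: the symmetrization of an invariant is the group order times it.
-/
theorem mem_range_symTensorToPoly {p : MvPolynomial (Σ k, Fin (n k)) ℂ}
    (hp : ∀ σ, blockRename n σ p = p) : p ∈ (symTensorToPoly n).range := by
  obtain ⟨x, hx⟩ := exists_symTensorToPoly_eq_sum n p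
  simp only [hp, Finset.sum_const, Finset.card_univ] at hx
  refine ⟨(Fintype.card (∀ k, Equiv.Perm (Fin (n k))) : ℂ)⁻¹ • x, ?_⟩
  change symTensorToPoly n _ = p
  rw [map_smul, hx, ← Nat.cast_smul_eq_nsmul ℂ,
    inv_smul_smul₀ (Nat.cast_ne_zero.2 Fintype.card_ne_zero)]

/-! ### The substitution homomorphism and its localization -/

variable {n} {N : ℕ} (e : (∀ k, Fin (n k)) ≃ Fin N)

/-- The substitution `λ^{(k)}_i ↦ α^{(k)}_{i_k}`. -/
def segreSubst (x : Fin r × Fin N) : Σ k, Fin (n k) := ⟨x.1, e.symm x.2 x.1⟩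

theorem blockRename_rename_segreSubst (σ : ∀ k, Equiv.Perm (Fin (n k))) (p : multiSym r N) :
    blockRename n σ (MvPolynomial.rename (segreSubst e) p.1) =
      MvPolynomial.rename (segreSubst e) p.1 := by
  -- The family `σ` permutes the multi-indices componentwise, which is a single element of `𝔖_N`
  -- under `e`.
  let τ : Equiv.Perm (Fin N) := e.symm.trans ((Equiv.piCongrRight σ).trans e)
  have h : Sigma.map id (fun k => σ k) ∘ segreSubst e = segreSubst e ∘ Prod.map id τ := by
    funext x
    simp [segreSubst, τ, Sigma.map]
    rfl
  rw [blockRename, MvPolynomial.rename_rename, h, ← MvPolynomial.rename_rename, p.2 τ]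

theorem existsUnique_isSubstitution :
    ∃! φ : multiSym r N →ₐ[ℂ] SymTensor n, IsSubstitution e φ := by
  have hinj := symTensorToPoly_injective n
  let E := AlgEquiv.ofInjective (symTensorToPoly n) hinj
  let ρ : multiSym r N →ₐ[ℂ] (symTensorToPoly n).range :=
    ((MvPolynomial.rename (segreSubst e)).comp (multiSym r N).val).codRestrict _ fun p =>
      mem_range_symTensorToPoly n fun σ => blockRename_rename_segreSubst e σ p
  refine ⟨E.symm.toAlgHom.comp ρ, fun p => ?_, fun φ hφ => ?_⟩
  · exact congrArg Subtype.val (E.apply_symm_apply (ρ p))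
  · refine AlgHom.ext fun p => hinj ?_
    rw [hφ p]
    exact (congrArg Subtype.val (E.apply_symm_apply (ρ p))).symm

instance : IsDomain (SymTensor n) := (symTensorToPoly_injective n).isDomain (symTensorToPoly n)

variable (n) in
theorem tensorDet_ne_zero : tensorDet n ≠ 0 := by
  intro h
  have := symTensorToPoly_tensorDet n
  rw [h, map_zero, eq_comm, Finset.prod_eq_zero_iff] at this
  obtain ⟨k, _, hk⟩ := this
  obtain ⟨i, _, hi⟩ := Finset.prod_eq_zero_iff.1 hk
  exact MvPolynomial.X_ne_zero _ hi

variable (n) in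
theorem powers_tensorDet_le : Submonoid.powers (tensorDet n) ≤ nonZeroDivisors (SymTensor n) :=
  powers_le_nonZeroDivisors_of_noZeroDivisors (tensorDet_ne_zero n)

instance : IsDomain (SymTensorLoc n) :=
  IsLocalization.isDomain_of_le_nonZeroDivisors (SymTensorLoc n) (powers_tensorDet_le n)

variable (n) in
theorem X_dvd_symTensorToPoly_tensorDet (k : Fin r) (j : Fin (n k)) :
    (MvPolynomial.X ⟨k, j⟩ : MvPolynomial (Σ k, Fin (n k)) ℂ) ∣
      symTensorToPoly n (tensorDet n) := by
  rw [symTensorToPoly_tensorDet]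
  have h : (MvPolynomial.X ⟨k, j⟩ : MvPolynomial (Σ k, Fin (n k)) ℂ) ∣
      ∏ i, MvPolynomial.X ⟨k, i⟩ := Finset.dvd_prod_of_mem _ (Finset.mem_univ j)
  exact h.trans (Finset.dvd_prod_of_mem
    (fun k => ∏ i, (MvPolynomial.X ⟨k, i⟩ : MvPolynomial (Σ k, Fin (n k)) ℂ)) (Finset.mem_univ k))

/-- Each of the `N * r` variables goes to some `α^{(k)}_j`, which divides the product of all of
them. This divisibility lives in the polynomial ring only. -/
theorem substitution_multiDet_dvd {φ : multiSym r N →ₐ[ℂ] SymTensor n}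
    (hφ : IsSubstitution e φ) :
    symTensorToPoly n (φ (multiDet r N)) ∣ symTensorToPoly n (tensorDet n) ^ (N * r) := by
  have hdet : symTensorToPoly n (φ (multiDet r N)) =
      ∏ k, ∏ i, MvPolynomial.X (segreSubst e (k, i)) := by
    rw [hφ]
    simp only [multiDet, map_prod, MvPolynomial.rename_X]
    rfl
  have := Finset.prod_dvd_prod_of_dvd _ _ fun (k : Fin r) (_ : k ∈ Finset.univ) =>
    Finset.prod_dvd_prod_of_dvd _ _ fun (i : Fin N) (_ : i ∈ Finset.univ) =>
      X_dvd_symTensorToPoly_tensorDet n k (e.symm i k)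
  simp only [Finset.prod_const, Finset.card_univ, Fintype.card_fin, ← pow_mul] at this
  rw [hdet]
  exact this

/-- The polynomial divisibility descends to `SymTensor n`, so the image divides a power of the
inverted element. -/
theorem isUnit_substitution_multiDet {φ : multiSym r N →ₐ[ℂ] SymTensor n}
    (hφ : IsSubstitution e φ) :
    IsUnit (algebraMap (SymTensor n) (SymTensorLoc n) (φ (multiDet r N))) := by
  have hdvd := substitution_multiDet_dvd e hφ
  rw [← map_pow] at hdvd
  obtain ⟨y, hy⟩ := hdvd
  have hblock : ∀ σ x, blockRename n σ (symTensorToPoly n x) = symTensorToPoly n x := by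
    intro σ x
    have : (blockRename n σ).comp (symTensorToPoly n) = symTensorToPoly n := by
      ext k p
      simp only [AlgHom.comp_apply]
      rw [symTensorToPoly_singleAlgHom, blockRename, MvPolynomial.rename_rename]
      have h : (Sigma.map id (fun k => σ k) : (Σ k, Fin (n k)) → Σ k, Fin (n k)) ∘ Sigma.mk k =
          Sigma.mk k ∘ σ k := rfl
      rw [h, ← MvPolynomial.rename_rename, p.2 (σ k)]
    exact DFunLike.congr_fun this x
  have h0 : symTensorToPoly n (φ (multiDet r N)) ≠ 0 := fun h => by
    rw [h, zero_mul, map_eq_zero_iff _ (symTensorToPoly_injective n)] at hy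
    exact pow_ne_zero _ (tensorDet_ne_zero n) hy
  -- In a domain the quotient of two invariants is invariant, so the cofactor `y` comes from
  -- `SymTensor n`.
  obtain ⟨z, hz⟩ := mem_range_symTensorToPoly n (p := y) fun σ => by
    apply mul_left_cancel₀ h0
    rw [← hy, ← hblock σ (φ _), ← map_mul, ← hy, hblock]
  have hz' : symTensorToPoly n z = y := hz
  rw [← hz', ← map_mul] at hy
  have hu := (IsLocalization.Away.algebraMap_isUnit (S := SymTensorLoc n) (tensorDet n)).pow (N * r)
  rw [← map_pow, symTensorToPoly_injective n hy, map_mul] at hu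
  exact isUnit_of_mul_isUnit_left hu

/-- Evaluation of elements of `SymTensor n` at a point of the product of affine spaces. -/
def evalSym (t : ∀ k, Fin (n k) → ℂ) : SymTensor n →ₐ[ℂ] ℂ :=
  (MvPolynomial.aeval fun x : Σ k, Fin (n k) => t x.1 x.2).comp (symTensorToPoly n)

theorem evalSym_singleAlgHom (t : ∀ k, Fin (n k) → ℂ) (k : Fin r)
    (p : MvPolynomial.symmetricSubalgebra (Fin (n k)) ℂ) :
    evalSym t (PiTensorProduct.singleAlgHom k p) = MvPolynomial.aeval (t k) p.1 := by
  rw [evalSym, AlgHom.comp_apply, symTensorToPoly_singleAlgHom, MvPolynomial.aeval_rename]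
  rfl

theorem evalSym_substitution {φ : multiSym r N →ₐ[ℂ] SymTensor n} (hφ : IsSubstitution e φ)
    (t : ∀ k, Fin (n k) → ℂ) (p : multiSym r N) :
    evalSym t (φ p) = MvPolynomial.aeval (fun x : Fin r × Fin N => t x.1 (e.symm x.2 x.1)) p.1 := by
  rw [evalSym, AlgHom.comp_apply, hφ, MvPolynomial.aeval_rename]
  rfl

/-- After multiplication by the product of all variables, both sides vanish off the torus, so they
agree at every point. -/
theorem evalSym_torus_injective {x y : SymTensor n}
    (h : ∀ s : ∀ k, Fin (n k) → ℂˣ,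
      evalSym (fun k i => (s k i : ℂ)) x = evalSym (fun k i => (s k i : ℂ)) y) : x = y := by
  apply symTensorToPoly_injective n
  have h0 : (∏ k, ∏ i, MvPolynomial.X ⟨k, i⟩ : MvPolynomial (Σ k, Fin (n k)) ℂ) ≠ 0 := by
    rw [← symTensorToPoly_tensorDet, Ne, map_eq_zero_iff _ (symTensorToPoly_injective n)]
    exact tensorDet_ne_zero n
  apply mul_left_cancel₀ h0
  refine MvPolynomial.funext fun t => ?_
  rw [map_mul, map_mul]
  by_cases ht : ∀ k i, t ⟨k, i⟩ ≠ 0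
  · congr 1
    simpa [evalSym, MvPolynomial.aeval_eq_eval] using h fun k i => Units.mk0 _ (ht k i)
  · push Not at ht
    obtain ⟨k, i, hki⟩ := ht
    have : MvPolynomial.eval t
        (∏ k, ∏ i, MvPolynomial.X ⟨k, i⟩ : MvPolynomial (Σ k, Fin (n k)) ℂ) = 0 := by
      simp only [map_prod, MvPolynomial.eval_X]
      exact Finset.prod_eq_zero (Finset.mem_univ k) (Finset.prod_eq_zero (Finset.mem_univ i) hki)
    rw [this, zero_mul, zero_mul]

theorem evalTensor_algebraMap (s : ∀ k, Fin (n k) → ℂˣ) (x : SymTensor n) :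
    evalTensor s (algebraMap (SymTensor n) (SymTensorLoc n) x) =
      evalSym (fun k i => (s k i : ℂ)) x :=
  IsLocalization.lift_eq _ x

theorem evalMulti_algebraMap (t : Fin r → Fin N → ℂˣ) (p : multiSym r N) :
    evalMulti t (algebraMap (multiSym r N) (MultiSymLoc r N) p) =
      MvPolynomial.aeval (fun x : Fin r × Fin N => (t x.1 x.2 : ℂ)) p.1 :=
  IsLocalization.lift_eq _ p

theorem evalTensor_injective {x y : SymTensorLoc n}
    (h : ∀ s : ∀ k, Fin (n k) → ℂˣ, evalTensor s x = evalTensor s y) : x = y := by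
  -- A common denominator reduces the claim to `SymTensor n`.
  obtain ⟨d, hd⟩ := IsLocalization.exist_integer_multiples_of_finset
    (Submonoid.powers (tensorDet n)) ({x, y} : Set (SymTensorLoc n)).toFinite.toFinset
  obtain ⟨x', hx⟩ := hd x (by simp)
  obtain ⟨y', hy⟩ := hd y (by simp)
  rw [Algebra.smul_def] at hx hy
  have hxy : x' = y' := evalSym_torus_injective fun s => by
    rw [← evalTensor_algebraMap, ← evalTensor_algebraMap, hx, hy, map_mul, map_mul, h s]
  rw [hxy, hy] at hx
  exact ((IsLocalization.map_units (SymTensorLoc n) d).mul_left_cancel hx).symm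

end

/-! ### Character varieties as distinguished open subsets -/

section

variable {r n : ℕ}

/-- The product of the determinants of the entries of a commuting tuple. -/
def detInv (r n : ℕ) : invariants (tupleConj r n) (tupleCoord r n) :=
  ⟨fun A => ∏ k, (A.1 k).det, by
    have h : (fun A : CommTuple r n => ∏ k, (A.1 k).det) =
        (∏ k, (genericMatrix r n k).det : tupleCoord r n).1 := by
      funext A
      rw [← evalTuple_apply, map_prod]
      simp only [AlgHom.map_det, mapMatrix_genericMatrix]
    rw [h]
    exact Subtype.property _, fun g A => by
    refine Finset.prod_congr rfl fun k _ => ?_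
    exact Matrix.det_units_conj g _⟩

theorem detInv_apply (A : CommTuple r n) : (detInv r n).1 A = ∏ k, (A.1 k).det := rfl

theorem detInv_toTuple_ne_zero (ρ : RepSpace r n) : (detInv r n).1 (toTuple ρ) ≠ 0 :=
  (detInv_apply (toTuple ρ)).trans_ne <| Finset.prod_ne_zero_iff.2 fun k _ =>
    ((Matrix.isUnit_iff_isUnit_det _).1 (ρ (gen k)).isUnit).ne_zero

theorem exists_toTuple_eq {A : CommTuple r n} (hA : (detInv r n).1 A ≠ 0) :
    ∃ ρ, toTuple ρ = A := by
  have hu : ∀ k, IsUnit (A.1 k) := fun k => (Matrix.isUnit_iff_isUnit_det _).2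
    (isUnit_iff_ne_zero.2 (Finset.prod_ne_zero_iff.1
      ((detInv_apply A).symm.trans_ne hA) k (Finset.mem_univ k)))
  choose u hu using hu
  have hcomm : ∀ k l, Commute (u k) (u l) := fun k l => Units.ext (by
    simp only [Units.val_mul, hu]
    exact A.2 k l)
  have hcomm' : Pairwise fun k l => ∀ x y : Multiplicative ℤ,
      Commute (zpowersHom (GL (Fin n) ℂ) (u k) x) (zpowersHom (GL (Fin n) ℂ) (u l) y) :=
    fun k l _ x y => (hcomm k l).zpow_zpow _ _
  refine ⟨(MonoidHom.noncommPiCoprod (fun k => zpowersHom (GL (Fin n) ℂ) (u k)) hcomm').comp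
    (MulEquiv.funMultiplicative (Fin r) ℤ).toMonoidHom, Subtype.ext (funext fun k => ?_)⟩
  · have h : MulEquiv.funMultiplicative (Fin r) ℤ (gen k) =
        Pi.mulSingle k (Multiplicative.ofAdd 1) := by
      funext l
      by_cases hl : l = k
      · subst hl; simp [gen]
      · simp [gen, hl]
    simp only [toTuple, MonoidHom.comp_apply, MulEquiv.toMonoidHom_eq_coe, MonoidHom.coe_coe, h,
      MonoidHom.noncommPiCoprod_mulSingle]
    simp [hu]

theorem gen_closure_induction {P : Multiplicative (Fin r → ℤ) → Prop} (one : P 1)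
    (mul : ∀ a b, P a → P b → P (a * b)) (of : ∀ k, P (gen k)) (inv : ∀ k, P (gen k)⁻¹)
    (a : Multiplicative (Fin r → ℤ)) : P a := by
  let S : Submonoid (Multiplicative (Fin r → ℤ)) :=
    { carrier := {a | P a}, one_mem' := one, mul_mem' := fun {a b} ha hb => mul a b ha hb }
  have ha : a = ∏ k, gen k ^ (Multiplicative.toAdd a k) := by
    apply Multiplicative.toAdd.injective
    funext l
    simp [gen, toAdd_prod, Finset.sum_apply, Pi.single_apply]
  rw [ha]
  refine S.prod_mem fun k _ => ?_
  obtain ⟨m, hm | hm⟩ := Int.eq_nat_or_neg (Multiplicative.toAdd a k)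
  · rw [hm, zpow_natCast]
    exact S.pow_mem (of k) m
  · rw [hm, zpow_neg, zpow_natCast, ← inv_pow]
    exact S.pow_mem (inv k) m

/-- The functions on the representation space that become regular on commuting tuples after
multiplication with a power of the determinant. -/
def detBounded (r n : ℕ) : Subalgebra ℂ (RepSpace r n → ℂ) where
  carrier := {g | ∃ m : ℕ, ∃ f ∈ tupleCoord r n,
    ∀ ρ, g ρ * (detInv r n).1 (toTuple ρ) ^ m = f (toTuple ρ)}
  mul_mem' := by
    rintro g g' ⟨m, f, hf, h⟩ ⟨m', f', hf', h'⟩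
    refine ⟨m + m', f * f', (tupleCoord r n).mul_mem hf hf', fun ρ => ?_⟩
    rw [Pi.mul_apply, Pi.mul_apply, ← h, ← h']
    ring
  add_mem' := by
    rintro g g' ⟨m, f, hf, h⟩ ⟨m', f', hf', h'⟩
    have hd := (detInv r n).2.1
    refine ⟨m + m', f * (detInv r n).1 ^ m' + f' * (detInv r n).1 ^ m,
      (tupleCoord r n).add_mem ((tupleCoord r n).mul_mem hf ((tupleCoord r n).pow_mem hd _))
        ((tupleCoord r n).mul_mem hf' ((tupleCoord r n).pow_mem hd _)), fun ρ => ?_⟩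
    simp only [Pi.mul_apply, Pi.add_apply, Pi.pow_apply, ← h, ← h']
    ring
  algebraMap_mem' c := ⟨0, _, (tupleCoord r n).algebraMap_mem c, fun ρ => by
    simp⟩

theorem repCoord_le_detBounded : repCoord r n ≤ detBounded r n := by
  refine Algebra.adjoin_le ?_
  rintro _ ⟨a, i, j, rfl⟩
  revert i j
  refine gen_closure_induction (P := fun a => ∀ i j,
    (fun ρ : RepSpace r n => (ρ a : Matrix (Fin n) (Fin n) ℂ) i j) ∈ detBounded r n)
    (fun i j => ?_) (fun a b ha hb i j => ?_) (fun k i j => ?_) (fun k i j => ?_) a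
  · simp only [map_one, Units.val_one]
    exact (detBounded r n).algebraMap_mem _
  · have : (fun ρ : RepSpace r n => (ρ (a * b) : Matrix (Fin n) (Fin n) ℂ) i j) =
        ∑ l, (fun ρ : RepSpace r n => (ρ a : Matrix (Fin n) (Fin n) ℂ) i l) *
          fun ρ : RepSpace r n => (ρ b : Matrix (Fin n) (Fin n) ℂ) l j := by
      funext ρ
      simp [Matrix.mul_apply, Finset.sum_apply]
    rw [this]
    exact (detBounded r n).sum_mem fun l _ => (detBounded r n).mul_mem (ha i l) (hb l j)
  · exact ⟨0, _, (genericMatrix r n k i j).2, fun ρ => by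
      rw [pow_zero, mul_one]; rfl⟩
  -- By Cramer's rule the inverse is the adjugate over `det A_k`; the remaining determinants
  -- complete the denominator to the full product, so exponent `1` suffices.
  · let F : tupleCoord r n := (genericMatrix r n k).adjugate i j *
      ∏ l ∈ Finset.univ.erase k, (genericMatrix r n l).det
    refine ⟨1, F.1, F.2, fun ρ => ?_⟩
    have hF : F.1 (toTuple ρ) = ((toTuple ρ).1 k).adjugate i j *
        ∏ l ∈ Finset.univ.erase k, ((toTuple ρ).1 l).det := by
      rw [← evalTuple_apply]
      simp only [F, map_mul, map_prod, AlgHom.map_det, mapMatrix_genericMatrix]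
      rw [← mapMatrix_genericMatrix (toTuple ρ) k, ← AlgHom.map_adjugate]
      rfl
    have hdet : ((toTuple ρ).1 k).det ≠ 0 :=
      ((Matrix.isUnit_iff_isUnit_det _).1 (ρ (gen k)).isUnit).ne_zero
    have hinv : ((ρ (gen k)⁻¹ : GL (Fin n) ℂ) : Matrix (Fin n) (Fin n) ℂ) =
        ((toTuple ρ).1 k).det⁻¹ • ((toTuple ρ).1 k).adjugate := by
      rw [map_inv, Matrix.coe_units_inv, Matrix.inv_def, Ring.inverse_eq_inv']
      rfl
    change ((ρ (gen k)⁻¹ : GL (Fin n) ℂ) : Matrix (Fin n) (Fin n) ℂ) i j * _ = F.1 (toTuple ρ)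
    rw [hF, hinv, pow_one, detInv_apply, ← Finset.mul_prod_erase _ _ (Finset.mem_univ k),
      Matrix.smul_apply, smul_eq_mul]
    field_simp

instance : Algebra (invariants (tupleConj r n) (tupleCoord r n))
    (invariants (repConj r n) (repCoord r n)) := (restrictInv r n).toRingHom.toAlgebra

instance : IsScalarTower ℂ (invariants (tupleConj r n) (tupleCoord r n))
    (invariants (repConj r n) (repCoord r n)) := IsScalarTower.of_algebraMap_eq fun _ => rfl

theorem toTuple_repConj (g : GL (Fin n) ℂ) (ρ : RepSpace r n) :
    toTuple (repConj r n g ρ) = tupleConj r n g (toTuple ρ) := rfl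

/-- The inverse is the product of the determinants of the `ρ(e_k)⁻¹`, which is regular because the
entries of `ρ(a)` are coordinates for every `a`, negative ones included. -/
theorem isUnit_restrictInv_detInv : IsUnit (restrictInv r n (detInv r n)) := by
  let w : RepSpace r n → ℂ := fun ρ =>
    ∏ k, ((ρ (gen k)⁻¹ : GL (Fin n) ℂ) : Matrix (Fin n) (Fin n) ℂ).det
  have hw : w ∈ repCoord r n := by
    have : w = ∏ k, ∑ σ : Equiv.Perm (Fin n), algebraMap ℂ _ (Equiv.Perm.sign σ : ℂ) *
        ∏ i, fun ρ : RepSpace r n =>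
          ((ρ (gen k)⁻¹ : GL (Fin n) ℂ) : Matrix (Fin n) (Fin n) ℂ) (σ i) i := by
      funext ρ
      simp [w, Matrix.det_apply', Finset.prod_apply, Finset.sum_apply]
    rw [this]
    exact (repCoord r n).prod_mem fun k _ => (repCoord r n).sum_mem fun σ _ =>
      (repCoord r n).mul_mem ((repCoord r n).algebraMap_mem _)
        ((repCoord r n).prod_mem fun i _ => Algebra.subset_adjoin ⟨_, _, _, rfl⟩)
  refine IsUnit.of_mul_eq_one ⟨w, hw, fun g ρ => Finset.prod_congr rfl fun k _ =>
    Matrix.det_units_conj g _⟩ (Subtype.ext (funext fun ρ => ?_))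
  change (∏ k, ((toTuple ρ).1 k).det) * ∏ k, _ = 1
  rw [← Finset.prod_mul_distrib]
  refine Finset.prod_eq_one fun k _ => ?_
  rw [← Matrix.det_mul]
  change Matrix.det ((ρ (gen k) : Matrix (Fin n) (Fin n) ℂ) *
    ((ρ (gen k)⁻¹ : GL (Fin n) ℂ) : Matrix (Fin n) (Fin n) ℂ)) = 1
  rw [← Units.val_mul, ← map_mul, mul_inv_cancel, map_one, Units.val_one, Matrix.det_one]

instance isLocalization_detInv : IsLocalization.Away (detInv r n)
    (invariants (repConj r n) (repCoord r n)) := by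
  refine (isLocalization_iff _ _).2 ⟨?_, fun g => ?_, fun {f f'} h => ?_⟩
  · rintro ⟨_, m, rfl⟩
    rw [map_pow]
    exact isUnit_restrictInv_detInv.pow m
  · obtain ⟨m, f, hf, h⟩ := repCoord_le_detBounded g.2.1
    -- The numerator `f` need be invariant only where the determinants are nonzero; one more factor
    -- of `detInv` makes it vanish elsewhere. This explains the exponent `m + 1` below.
    have hinv : ∀ x A, (f * (detInv r n).1) (tupleConj r n x A) = (f * (detInv r n).1) A := by
      intro x A
      rw [Pi.mul_apply, Pi.mul_apply, (detInv r n).2.2]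
      by_cases hA : (detInv r n).1 A = 0
      · rw [hA, mul_zero, mul_zero]
      · obtain ⟨ρ, rfl⟩ := exists_toTuple_eq hA
        rw [← toTuple_repConj, ← h, ← h, g.2.2, toTuple_repConj, (detInv r n).2.2]
    refine ⟨(⟨_, (tupleCoord r n).mul_mem hf (detInv r n).2.1, hinv⟩,
      ⟨detInv r n ^ (m + 1), _, rfl⟩), Subtype.ext (funext fun ρ => ?_)⟩
    change g.1 ρ * (detInv r n).1 (toTuple ρ) ^ (m + 1) =
      f (toTuple ρ) * (detInv r n).1 (toTuple ρ)
    rw [← h]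
    ring
  -- Functions that agree on representations agree on all tuples once multiplied by `detInv`.
  · refine ⟨⟨detInv r n, Submonoid.mem_powers _⟩, Subtype.ext (funext fun A => ?_)⟩
    change (detInv r n).1 A * f.1 A = (detInv r n).1 A * f'.1 A
    by_cases hA : (detInv r n).1 A = 0
    · rw [hA, zero_mul, zero_mul]
    · obtain ⟨ρ, rfl⟩ := exists_toTuple_eq hA
      exact congrArg _ (congrFun (congrArg Subtype.val h) ρ)

theorem algHom_ext_restrictInv {R : Type*} [CommRing R] [Algebra ℂ R]
    {f g : invariants (repConj r n) (repCoord r n) →ₐ[ℂ] R}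
    (h : f.comp (restrictInv r n) = g.comp (restrictInv r n)) : f = g :=
  IsLocalization.algHom_ext (Submonoid.powers (detInv r n)) h

theorem evalInv_comp_restrictInv (ρ : RepSpace r n) :
    (evalInv (repConj r n) (repCoord r n) ρ).comp (restrictInv r n) =
      evalInv (tupleConj r n) (tupleCoord r n) (toTuple ρ) := rfl

theorem toTuple_diagRep (t : Fin r → Fin n → ℂˣ) :
    toTuple (diagRep t) = diagTuple fun k i => (t k i : ℂ) := by
  apply Subtype.ext
  funext k
  change Matrix.diagonal _ = Matrix.diagonal _
  congr 1
  funext i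
  rw [Finset.prod_eq_single k]
  · simp [gen]
  · intro l _ hl
    simp [gen, hl]
  · simp

theorem evalInv_eq_of_degenerates {A B : CommTuple r n} (h : Degenerates A B) :
    evalInv (tupleConj r n) (tupleCoord r n) A = evalInv (tupleConj r n) (tupleCoord r n) B :=
  AlgHom.ext h.eval_eq

/-- A representation of `ℤ` degenerates to a diagonal one. -/
theorem exists_degenerates_diagRep (ρ : RepSpace r n) :
    ∃ t : Fin r → Fin n → ℂˣ, Degenerates (toTuple ρ) (toTuple (diagRep t)) := by
  obtain ⟨t, ht⟩ := exists_degenerates_diagTuple (toTuple ρ)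
  -- The product of the determinants is an invariant, so it stays nonzero in the limit.
  have h0 : ∀ k i, t k i ≠ 0 := by
    have := detInv_toTuple_ne_zero ρ
    rw [ht.eval_eq, detInv_apply] at this
    intro k i
    have := Finset.prod_ne_zero_iff.1 this k (Finset.mem_univ k)
    simp only [diagTuple, Matrix.det_diagonal] at this
    exact Finset.prod_ne_zero_iff.1 this i (Finset.mem_univ i)
  exact ⟨fun k i => Units.mk0 _ (h0 k i), by rw [toTuple_diagRep]; exact ht⟩

end

theorem toTuple_tensorRep {r : ℕ} {n : Fin r → ℕ} {N : ℕ} (e : (∀ k, Fin (n k)) ≃ Fin N)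
    (ρ : ∀ k, RepSpace 1 (n k)) :
    toTuple (tensorRep e ρ) = tensorTuple e fun k => toTuple (ρ k) := by
  apply Subtype.ext
  funext k
  change tensorMatrix e _ = tensorMatrix e _
  congr 1
  funext l
  by_cases h : l = k
  · subst h
    rw [Pi.mulSingle_eq_same]
    refine congrArg (fun a => (ρ l a : Matrix (Fin (n l)) (Fin (n l)) ℂ)) ?_
    apply Multiplicative.toAdd.injective
    funext i
    simp [gen, Subsingleton.elim i 0]
  · rw [Pi.mulSingle_eq_of_ne h]
    have : (Multiplicative.ofAdd fun _ => Multiplicative.toAdd (gen k) l :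
        Multiplicative (Fin 1 → ℤ)) = 1 := by
      apply Multiplicative.toAdd.injective
      funext i
      simp [gen, h]
    rw [this, map_one, Units.val_one]

/-! ### The coordinate rings of the character varieties -/

/-- The isomorphism `E` matches `detInv` with the product of all variables, hence extends to the
localizations. -/
theorem exists_repInvariants_equiv_multiSymLoc {r N : ℕ}
    (E : invariants (tupleConj r N) (tupleCoord r N) ≃ₐ[ℂ] multiSym r N)
    (hE : ∀ f (t : Fin r → Fin N → ℂ),
      MvPolynomial.aeval (fun x => t x.1 x.2) (E f).1 = f.1 (diagTuple t)) :
    ∃ E' : invariants (repConj r N) (repCoord r N) ≃ₐ[ℂ] MultiSymLoc r N,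
      ∀ f, E' (restrictInv r N f) = algebraMap _ _ (E f) := by
  have hdet : E (detInv r N) = multiDet r N := Subtype.ext (aeval_injective fun t => by
    rw [hE]
    simp [detInv, diagTuple, multiDet])
  have H : (Submonoid.powers (detInv r N)).map E.toRingEquiv.toMonoidHom =
      Submonoid.powers (multiDet r N) := by
    rw [Submonoid.map_powers]
    exact congrArg _ hdet
  let E' := IsLocalization.ringEquivOfRingEquiv (invariants (repConj r N) (repCoord r N))
    (MultiSymLoc r N) E.toRingEquiv H
  have hE' : ∀ f, E' (restrictInv r N f) = algebraMap _ _ (E f) :=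
    fun f => IsLocalization.ringEquivOfRingEquiv_eq H f
  refine ⟨AlgEquiv.ofRingEquiv (f := E') fun c => ?_, hE'⟩
  rw [← AlgHom.commutes (restrictInv r N) c, hE', AlgEquiv.commutes]
  rfl

/-! ### Coproduct properties of `SymTensor` and `SymTensorLoc` -/

section Coproduct

variable {r : ℕ} {n : Fin r → ℕ}

theorem existsUnique_symTensor_algHom {R : Type} [CommRing R] [Algebra ℂ R]
    {A : Fin r → Type} [∀ k, CommRing (A k)] [∀ k, Algebra ℂ (A k)]
    (E : ∀ k, A k ≃ₐ[ℂ] MvPolynomial.symmetricSubalgebra (Fin (n k)) ℂ)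
    (f : ∀ k, A k →ₐ[ℂ] R) :
    ∃! g : SymTensor n →ₐ[ℂ] R, ∀ k,
      g.comp ((PiTensorProduct.singleAlgHom k).comp (E k).toAlgHom) = f k := by
  let g : SymTensor n →ₐ[ℂ] R := PiTensorProduct.liftAlgHom
    ((MultilinearMap.mkPiAlgebra ℂ (Fin r) R).compLinearMap
      fun k => ((f k).comp (E k).symm.toAlgHom).toLinearMap)
    (by simp) (by intro x y; simp [Finset.prod_mul_distrib])
  have hg : ∀ p, g (PiTensorProduct.tprod ℂ p) = ∏ k, f k ((E k).symm (p k)) := fun p => by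
    simp [g]
  refine ⟨g, fun k => AlgHom.ext fun x => ?_, fun g' hg' => ?_⟩
  · rw [AlgHom.comp_apply, AlgHom.comp_apply, PiTensorProduct.singleAlgHom_apply, hg,
      Finset.prod_eq_single k]
    · simp
    · intro l _ hl
      simp [Pi.mulSingle_eq_of_ne hl]
    · simp
  · refine PiTensorProduct.algHom_ext fun k => AlgHom.ext fun p => ?_
    have h : g' (PiTensorProduct.singleAlgHom k p) = f k ((E k).symm p) :=
      (congrArg (fun q => g' (PiTensorProduct.singleAlgHom k q))
        ((E k).apply_symm_apply p)).symm.trans (DFunLike.congr_fun (hg' k) ((E k).symm p))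
    rw [AlgHom.comp_apply, AlgHom.comp_apply, h, PiTensorProduct.singleAlgHom_apply, hg,
      Finset.prod_eq_single k]
    · simp
    · intro l _ hl
      simp [Pi.mulSingle_eq_of_ne hl]
    · simp

variable (E : ∀ k, invariants (tupleConj 1 (n k)) (tupleCoord 1 (n k)) ≃ₐ[ℂ]
    MvPolynomial.symmetricSubalgebra (Fin (n k)) ℂ)
  (hE : ∀ k f (t : Fin (n k) → ℂ), MvPolynomial.aeval t (E k f).1 = f.1 (diagTuple fun _ => t))

include hE in
theorem equiv_detInv (k : Fin r) : E k (detInv 1 (n k)) = symDet (n k) :=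
  Subtype.ext (MvPolynomial.funext fun t => by
    rw [← MvPolynomial.aeval_eq_eval]
    refine (hE k _ t).trans ?_
    simp [detInv, diagTuple, symDet])

-- The determinant of the `k`-th factor divides `tensorDet n`, hence becomes invertible.
include hE in
theorem exists_repInvariants_algHom (k : Fin r) :
    ∃ i : invariants (repConj 1 (n k)) (repCoord 1 (n k)) →ₐ[ℂ] SymTensorLoc n,
      ∀ f, i (restrictInv 1 (n k) f) =
        algebraMap (SymTensor n) _ (PiTensorProduct.singleAlgHom k (E k f)) := by
  let j : invariants (tupleConj 1 (n k)) (tupleCoord 1 (n k)) →ₐ[ℂ] SymTensorLoc n :=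
    (Algebra.algHom ℂ (SymTensor n) (SymTensorLoc n)).comp
      ((PiTensorProduct.singleAlgHom k).comp (E k).toAlgHom)
  have hj : IsUnit (j (detInv 1 (n k))) := by
    have hdvd : PiTensorProduct.singleAlgHom k (symDet (n k)) ∣ tensorDet n := by
      rw [tensorDet, ← Finset.univ_prod_mulSingle fun k => symDet (n k),
        PiTensorProduct.tprod_prod]
      exact Finset.dvd_prod_of_mem (fun k => PiTensorProduct.tprod ℂ
        (Pi.mulSingle (M := fun k => MvPolynomial.symmetricSubalgebra (Fin (n k)) ℂ)
          k (symDet (n k)))) (Finset.mem_univ k)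
    rw [← equiv_detInv E hE k] at hdvd
    exact isUnit_of_dvd_unit (map_dvd (algebraMap (SymTensor n) (SymTensorLoc n)) hdvd)
      (IsLocalization.Away.algebraMap_isUnit _)
  refine ⟨IsLocalization.liftAlgHom (M := Submonoid.powers (detInv 1 (n k))) (f := j) ?_,
    fun f => IsLocalization.lift_eq _ f⟩
  rintro ⟨_, m, rfl⟩
  rw [map_pow]
  exact hj.pow m

-- Inverting the product of the determinants in the coproduct is the same as inverting each
-- determinant in its own factor.
include hE in
theorem existsUnique_symTensorLoc_algHom
    {i : ∀ k, invariants (repConj 1 (n k)) (repCoord 1 (n k)) →ₐ[ℂ] SymTensorLoc n}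
    (hi : ∀ k f, i k (restrictInv 1 (n k) f) =
      algebraMap (SymTensor n) _ (PiTensorProduct.singleAlgHom k (E k f)))
    {R : Type} [CommRing R] [Algebra ℂ R]
    (f : ∀ k, invariants (repConj 1 (n k)) (repCoord 1 (n k)) →ₐ[ℂ] R) :
    ∃! g : SymTensorLoc n →ₐ[ℂ] R, ∀ k, g.comp (i k) = f k := by
  obtain ⟨g, hg, hguniq⟩ := existsUnique_symTensor_algHom E
    fun k => (f k).comp (restrictInv 1 (n k))
  have hg' : ∀ k x, g (PiTensorProduct.singleAlgHom k (E k x)) = f k (restrictInv 1 (n k) x) :=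
    fun k => DFunLike.congr_fun (hg k)
  have hu : IsUnit (g (tensorDet n)) := by
    rw [tensorDet, ← Finset.univ_prod_mulSingle fun k => symDet (n k),
      PiTensorProduct.tprod_prod, map_prod]
    refine (Submonoid.prod_mem (IsUnit.submonoid R) fun k _ => ?_ :)
    have h := hg' k (detInv 1 (n k))
    rw [equiv_detInv E hE k] at h
    exact h ▸ isUnit_restrictInv_detInv.map (f k)
  have hu' : ∀ y : Submonoid.powers (tensorDet n), IsUnit (g y) := by
    rintro ⟨_, m, rfl⟩
    rw [map_pow]
    exact hu.pow m
  refine ⟨IsLocalization.liftAlgHom hu', fun k => ?_, fun h hh => ?_⟩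
  · refine algHom_ext_restrictInv (AlgHom.ext fun x => ?_)
    rw [AlgHom.comp_apply, AlgHom.comp_apply, hi, AlgHom.comp_apply, ← hg']
    exact IsLocalization.lift_eq _ _
  · refine IsLocalization.algHom_ext (Submonoid.powers (tensorDet n)) ?_
    have h1 : h.comp (Algebra.algHom ℂ (SymTensor n) (SymTensorLoc n)) = g :=
      hguniq _ fun k => AlgHom.ext fun x => by
        rw [← hh k]
        exact congrArg h (hi k x).symm
    rw [h1]
    exact AlgHom.ext fun x => (IsLocalization.lift_eq hu' x).symm

end Coproduct

/-! ### Morphisms of affine schemes over the complex numbers -/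

section

variable {A B C : Type} [CommRing A] [Algebra ℂ A] [CommRing B] [Algebra ℂ B] [CommRing C]
  [Algebra ℂ C]

instance : IsAffine (affOver A).left :=
  inferInstanceAs (IsAffine (Spec (CommRingCat.of A)))

theorem affMap_id : affMap (AlgHom.id ℂ A) = 𝟙 (affOver A) :=
  Over.OverMorphism.ext (Spec.map_id _)

theorem affMap_comp (f : A →ₐ[ℂ] B) (g : B →ₐ[ℂ] C) :
    affMap (g.comp f) = affMap g ≫ affMap f :=
  Over.OverMorphism.ext
    (Spec.map_comp (CommRingCat.ofHom f.toRingHom) (CommRingCat.ofHom g.toRingHom))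

theorem affMap_injective {f g : A →ₐ[ℂ] B} (h : affMap f = affMap g) : f = g := by
  have h' := Spec.map_injective (congrArg CommaMorphism.left h)
  exact AlgHom.ext fun a => congrArg (fun φ => φ.hom a) h'

theorem affMap_surjective (h : affOver B ⟶ affOver A) : ∃ f : A →ₐ[ℂ] B, affMap f = h := by
  obtain ⟨φ, hφ⟩ := Spec.map_surjective h.left
  have hw : Spec.map φ ≫ Spec.map (CommRingCat.ofHom (algebraMap ℂ A)) =
      Spec.map (CommRingCat.ofHom (algebraMap ℂ B)) := by
    rw [hφ]
    exact Over.w h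
  rw [← Spec.map_comp] at hw
  have hw' := Spec.map_injective hw
  exact ⟨{ φ.hom with commutes' := fun c => congrArg (fun ψ => ψ.hom c) hw' },
    Over.OverMorphism.ext hφ⟩

/-- An isomorphism of algebras as an isomorphism of spectra. -/
def affIso (E : A ≃ₐ[ℂ] B) : affOver B ≅ affOver A where
  hom := affMap E.toAlgHom
  inv := affMap E.symm.toAlgHom
  hom_inv_id := by
    rw [← affMap_comp, ← affMap_id]
    congr 1
    exact AlgHom.ext E.apply_symm_apply
  inv_hom_id := by
    rw [← affMap_comp, ← affMap_id]
    congr 1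
    exact AlgHom.ext E.symm_apply_apply

/-- Morphisms between affine schemes are determined by their values at sufficiently many points. -/
theorem hom_ext_of_points {ι : Type*} (p : ι → (B →ₐ[ℂ] ℂ))
    (hp : ∀ x y, (∀ i, p i x = p i y) → x = y) {f g : affOver B ⟶ affOver A}
    (h : ∀ i, affMap (p i) ≫ f = affMap (p i) ≫ g) : f = g := by
  obtain ⟨f, rfl⟩ := affMap_surjective f
  obtain ⟨g, rfl⟩ := affMap_surjective g
  congr 1
  refine AlgHom.ext fun a => hp _ _ fun i => ?_
  have := h i
  rw [← affMap_comp, ← affMap_comp] at this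
  exact DFunLike.congr_fun (affMap_injective this) a

/-- Morphisms to an affine scheme are homomorphisms to the algebra of global sections. -/
def homEquivAlgHom (T : Over (Spec (CommRingCat.of ℂ))) (A : Type) [CommRing A] [Algebra ℂ A] :
    (A →ₐ[ℂ] ((algΓ (CommRingCat.of ℂ)).obj T).unop) ≃ (T ⟶ affOver A) where
  toFun g := (algΓAlgSpecAdjunction (CommRingCat.of ℂ)).homEquiv T
    (Opposite.op (CommAlgCat.of ℂ A)) (CommAlgCat.ofHom g).op
  invFun f := (((algΓAlgSpecAdjunction (CommRingCat.of ℂ)).homEquiv T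
    (Opposite.op (CommAlgCat.of ℂ A))).symm f).unop.hom
  left_inv g := congrArg (fun h => h.unop.hom) (((algΓAlgSpecAdjunction
    (CommRingCat.of ℂ)).homEquiv T (Opposite.op (CommAlgCat.of ℂ A))).symm_apply_apply
      (CommAlgCat.ofHom g).op)
  right_inv f := ((algΓAlgSpecAdjunction (CommRingCat.of ℂ)).homEquiv T
    (Opposite.op (CommAlgCat.of ℂ A))).apply_symm_apply f

theorem homEquivAlgHom_comp_affMap (T : Over (Spec (CommRingCat.of ℂ))) (f : A →ₐ[ℂ] B)
    (g : B →ₐ[ℂ] ((algΓ (CommRingCat.of ℂ)).obj T).unop) :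
    homEquivAlgHom T B g ≫ affMap f = homEquivAlgHom T A (g.comp f) :=
  ((algΓAlgSpecAdjunction (CommRingCat.of ℂ)).homEquiv_naturality_right
    (CommAlgCat.ofHom g).op (CommAlgCat.ofHom f).op).symm

/-- The spectrum of a coproduct of algebras is the product of their spectra. -/
theorem exists_iso_pi {ι S : Type} {A : ι → Type} [CommRing S] [Algebra ℂ S]
    [∀ k, CommRing (A k)] [∀ k, Algebra ℂ (A k)] [HasProduct fun k => affOver (A k)]
    (i : ∀ k, A k →ₐ[ℂ] S)
    (hi : ∀ {R : Type} [CommRing R] [Algebra ℂ R] (f : ∀ k, A k →ₐ[ℂ] R),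
      ∃! g : S →ₐ[ℂ] R, ∀ k, g.comp (i k) = f k) :
    ∃ η : affOver S ≅ ∏ᶜ fun k => affOver (A k), ∀ k, η.hom ≫ Pi.π _ k = affMap (i k) := by
  -- The test object need not be affine: morphisms from `T` to an affine scheme are homomorphisms
  -- into the global sections of `T`, where the universal property of `S` applies.
  have key : ∀ (T : Over (Spec (CommRingCat.of ℂ))) (f : ∀ k, T ⟶ affOver (A k)),
      ∃! g : T ⟶ affOver S, ∀ k, g ≫ affMap (i k) = f k := by
    intro T f
    obtain ⟨g, hg, hguniq⟩ := hi fun k => (homEquivAlgHom T (A k)).symm (f k)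
    refine ⟨homEquivAlgHom T S g, fun k => ?_, fun g' hg' => ?_⟩
    · rw [homEquivAlgHom_comp_affMap, hg, Equiv.apply_symm_apply]
    · obtain ⟨h, rfl⟩ := (homEquivAlgHom T S).surjective g'
      congr 1
      exact hguniq _ fun k => by
        rw [Equiv.eq_symm_apply, ← homEquivAlgHom_comp_affMap, hg']
  have hlim : IsLimit (Fan.mk (affOver S) fun k => affMap (i k)) :=
    Fan.IsLimit.mk _ (fun s => (key s.pt s.proj).choose)
      (fun s => (key s.pt s.proj).choose_spec.1)
      (fun s m hm => (key s.pt s.proj).choose_spec.2 m hm)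
  exact ⟨hlim.conePointUniqueUpToIso (limit.isLimit _),
    fun k => hlim.conePointUniqueUpToIso_hom_comp (limit.isLimit _) ⟨k⟩⟩

end

/-! ### Scheme-theoretic images of morphisms of affine schemes -/

/-- The morphism factors through the closed subscheme `Spec (B ⧸ ker φ)`, so its image is a closed
subscheme of that. Since `B ⧸ ker φ` embeds in `S`, no further equation can hold on the image. -/
theorem exists_image_iso {X Y : Scheme.{0}} (f : X ⟶ Y) {S B : CommRingCat.{0}} (a : Spec S ≅ X)
    (θ : Spec B ≅ Y) (φ : B ⟶ S) (h : a.hom ≫ f = Spec.map φ ≫ θ.hom) :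
    ∃ ψ : f.image ≅ Spec (CommRingCat.of (B ⧸ RingHom.ker φ.hom)),
      ψ.hom ≫ Spec.map (CommRingCat.ofHom (Ideal.Quotient.mk (RingHom.ker φ.hom))) ≫ θ.hom =
        f.imageι := by
  let q : B ⟶ CommRingCat.of (B ⧸ RingHom.ker φ.hom) :=
    CommRingCat.ofHom (Ideal.Quotient.mk (RingHom.ker φ.hom))
  let l : CommRingCat.of (B ⧸ RingHom.ker φ.hom) ⟶ S := CommRingCat.ofHom φ.hom.kerLift
  have hql : q ≫ l = φ := CommRingCat.hom_ext (RingHom.ext fun b => rfl)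
  have hq : IsClosedImmersion (Spec.map q) :=
    IsClosedImmersion.spec_of_surjective q Ideal.Quotient.mk_surjective
  let j := Spec.map q ≫ θ.hom
  have hf : (a.inv ≫ Spec.map l) ≫ j = f := by
    rw [Category.assoc, ← Spec.map_comp_assoc, hql, ← h, Iso.inv_hom_id_assoc]
  have hker : j.ker ≤ f.imageι.ker := by
    rw [Scheme.IdealSheafData.ker_subschemeι, ← hf]
    exact Scheme.Hom.le_ker_comp _ _
  let L := IsClosedImmersion.lift j f.imageι hker
  have hL : L ≫ j = f.imageι := IsClosedImmersion.lift_fac _ _ _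
  have : IsClosedImmersion (L ≫ j) := hL ▸ inferInstance
  have : IsClosedImmersion L := IsClosedImmersion.of_comp L j
  have hfac : f.toImage ≫ L = a.inv ≫ Spec.map l := by
    rw [← cancel_mono j, Category.assoc, hL, Scheme.Hom.toImage_imageι, hf]
  -- The injection of `B ⧸ ker φ` into `S` factors through the sections of the image. A closed
  -- immersion into an affine scheme that is injective on global sections is an isomorphism.
  have hinj : Function.Injective L.appTop := by
    have h1 : Function.Injective (a.inv ≫ Spec.map l).appTop := by
      have h2 : (a.inv ≫ Spec.map l).appTop ≫ a.hom.appTop ≫ (Scheme.ΓSpecIso S).hom =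
          (Scheme.ΓSpecIso _).hom ≫ l := by
        rw [← Scheme.ΓSpecIso_naturality, ← Scheme.Hom.comp_appTop_assoc, Iso.hom_inv_id_assoc]
      have h3 : Function.Injective ((Scheme.ΓSpecIso
          (CommRingCat.of (B ⧸ RingHom.ker φ.hom))).hom ≫ l) :=
        (RingHom.kerLift_injective φ.hom).comp (ConcreteCategory.bijective_of_isIso
          (Scheme.ΓSpecIso (CommRingCat.of (B ⧸ RingHom.ker φ.hom))).hom).1
      rw [← h2] at h3
      exact Function.Injective.of_comp (f := a.hom.appTop ≫ (Scheme.ΓSpecIso S).hom) h3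
    rw [← hfac, Scheme.Hom.comp_appTop] at h1
    exact Function.Injective.of_comp (f := f.toImage.appTop) h1
  have := IsClosedImmersion.isIso_of_injective_of_isAffine hinj
  exact ⟨asIso L, hL⟩

/-! ### The character varieties and the quiver moduli -/

theorem isOpenImmersion_charToQuiver (r n : ℕ) : IsOpenImmersion (charToQuiver r n).left :=
  IsOpenImmersion.of_isLocalization (S := invariants (repConj r n) (repCoord r n)) (detInv r n)

theorem range_charToQuiver (r n : ℕ) : Set.range (charToQuiver r n).left =
    {x : PrimeSpectrum (invariants (tupleConj r n) (tupleCoord r n)) |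
      detInv r n ∉ x.asIdeal} :=
  PrimeSpectrum.localization_away_comap_range (invariants (repConj r n) (repCoord r n))
    (detInv r n)

theorem charPoint_comp_charToQuiver {r n : ℕ} (ρ : RepSpace r n) :
    charPoint ρ ≫ charToQuiver r n = tuplePoint (toTuple ρ) :=
  (affMap_comp (restrictInv r n) (evalInv (repConj r n) (repCoord r n) ρ)).symm

theorem charPoint_eq_of_toTuple {r n : ℕ} {ρ ρ' : RepSpace r n}
    (h : Degenerates (toTuple ρ) (toTuple ρ')) : charPoint ρ = charPoint ρ' :=
  congrArg affMap (algHom_ext_restrictInv (evalInv_eq_of_degenerates h))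

section

variable {r : ℕ} {n : Fin r → ℕ} {N : ℕ} (e : (∀ k, Fin (n k)) ≃ Fin N)

/-- The data identifying the moduli of quiver representations and the character varieties with the
spectra of the explicit rings. -/
structure ExplicitRings (n : Fin r → ℕ) (N : ℕ) where
  E : invariants (tupleConj r N) (tupleCoord r N) ≃ₐ[ℂ] multiSym r N
  aeval_E : ∀ f (t : Fin r → Fin N → ℂ),
    MvPolynomial.aeval (fun x => t x.1 x.2) (E f).1 = f.1 (diagTuple t)
  E' : invariants (repConj r N) (repCoord r N) ≃ₐ[ℂ] MultiSymLoc r N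
  E'_restrictInv : ∀ f, E' (restrictInv r N f) = algebraMap _ _ (E f)
  D : ∀ k, invariants (tupleConj 1 (n k)) (tupleCoord 1 (n k)) ≃ₐ[ℂ]
    MvPolynomial.symmetricSubalgebra (Fin (n k)) ℂ
  aeval_D : ∀ k f (t : Fin (n k) → ℂ),
    MvPolynomial.aeval t (D k f).1 = f.1 (diagTuple fun _ => t)
  i : ∀ k, invariants (repConj 1 (n k)) (repCoord 1 (n k)) →ₐ[ℂ] SymTensorLoc n
  i_restrictInv : ∀ k f, i k (restrictInv 1 (n k) f) =
    algebraMap (SymTensor n) _ (PiTensorProduct.singleAlgHom k (D k f))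
  ηQ : affOver (SymTensor n) ≅ ∏ᶜ fun k => quiverModuli 1 (n k)
  ηQ_π : ∀ k, ηQ.hom ≫ Pi.π _ k =
    affMap ((PiTensorProduct.singleAlgHom k).comp (D k).toAlgHom)
  η : affOver (SymTensorLoc n) ≅ ∏ᶜ fun k => charVar 1 (n k)
  η_π : ∀ k, η.hom ≫ Pi.π _ k = affMap (i k)

theorem exists_iso_pi_symTensor {A : Fin r → Type} [∀ k, CommRing (A k)] [∀ k, Algebra ℂ (A k)]
    [HasProduct fun k => affOver (A k)] (i : ∀ k, A k →ₐ[ℂ] SymTensor n)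
    (hi : ∀ {R : Type} [CommRing R] [Algebra ℂ R] (f : ∀ k, A k →ₐ[ℂ] R),
      ∃! g : SymTensor n →ₐ[ℂ] R, ∀ k, g.comp (i k) = f k) :
    ∃ η : affOver (SymTensor n) ≅ ∏ᶜ fun k => affOver (A k), ∀ k, η.hom ≫ Pi.π _ k =
      affMap (i k) :=
  exists_iso_pi (S := SymTensor n) i fun f => hi f

theorem symTensor_hom_ext {B : Type} [CommRing B] [Algebra ℂ B]
    {f g : affOver (SymTensor n) ⟶ affOver B}
    (h : ∀ t : ∀ k, Fin (n k) → ℂ, affMap (evalSym t) ≫ f = affMap (evalSym t) ≫ g) : f = g := by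
  have hp : ∀ x y : SymTensor n, (∀ t, evalSym t x = evalSym t y) → x = y :=
    fun _ _ hxy => evalSym_torus_injective fun _ => hxy _
  have key := hom_ext_of_points (A := B) (B := SymTensor n) evalSym hp (f := f) (g := g)
  exact key h

variable (n N) in
theorem nonempty_explicitRings : Nonempty (ExplicitRings n N) := by
  obtain ⟨E, hE⟩ := exists_invariants_equiv_multiSym r N
  obtain ⟨E', hE'⟩ := exists_repInvariants_equiv_multiSymLoc E hE
  choose D hD using fun k => exists_invariants_equiv_symmetric (n k)
  choose i hi using exists_repInvariants_algHom D hD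
  obtain ⟨ηQ, hηQ⟩ := exists_iso_pi_symTensor
    (fun k => (PiTensorProduct.singleAlgHom k).comp (D k).toAlgHom)
    (fun {R} _ _ f => existsUnique_symTensor_algHom (R := R) D f)
  obtain ⟨η, hη⟩ := exists_iso_pi
    (A := fun k => invariants (repConj 1 (n k)) (repCoord 1 (n k))) i
    (fun f => existsUnique_symTensorLoc_algHom D hD hi f)
  exact ⟨⟨E, hE, E', hE', D, hD, i, hi, ηQ, hηQ, η, hη⟩⟩

namespace ExplicitRings

variable (X : ExplicitRings n N)

theorem affMap_evalSym_comp (t : ∀ k, Fin (n k) → ℂ) :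
    affMap (evalSym t) ≫ X.ηQ.hom = Pi.lift fun k => tuplePoint (diagTuple fun _ => t k) := by
  refine Limits.Pi.hom_ext _ _ fun k => ?_
  rw [Category.assoc, X.ηQ_π, Pi.lift_π]
  refine (affMap_comp _ _).symm.trans (congrArg affMap (AlgHom.ext fun f => ?_))
  exact (evalSym_singleAlgHom t k _).trans (X.aeval_D k f (t k))

theorem affMap_evalTensor_comp (s : ∀ k, Fin (n k) → ℂˣ) :
    affMap (evalTensor s) ≫ X.η.hom = Pi.lift fun k => charPoint (diagRep fun _ => s k) := by
  refine Limits.Pi.hom_ext _ _ fun k => ?_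
  rw [Category.assoc, X.η_π, Pi.lift_π]
  refine (affMap_comp _ _).symm.trans (congrArg affMap
    (algHom_ext_restrictInv (AlgHom.ext fun f => ?_)))
  rw [evalInv_comp_restrictInv, toTuple_diagRep]
  refine (congrArg (evalTensor s) (X.i_restrictInv k f)).trans ?_
  rw [evalTensor_algebraMap, evalSym_singleAlgHom]
  exact X.aeval_D k f _

/-- The identification of the spectrum of the localized ring of multisymmetric polynomials with
the character variety. -/
def θ : affOver (MultiSymLoc r N) ≅ charVar r N := affIso X.E'

theorem affMap_evalMulti_comp (t : Fin r → Fin N → ℂˣ) :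
    affMap (evalMulti t) ≫ X.θ.hom = charPoint (diagRep t) := by
  refine (affMap_comp _ _).symm.trans (congrArg affMap
    (algHom_ext_restrictInv (AlgHom.ext fun f => ?_)))
  rw [evalInv_comp_restrictInv, toTuple_diagRep]
  refine (congrArg (evalMulti t) (X.E'_restrictInv f)).trans ?_
  rw [evalMulti_algebraMap]
  exact X.aeval_E f fun k i => t k i

/-- The identification of the spectrum of the ring of multisymmetric polynomials with the moduli
space of commuting tuples. -/
def θQ : affOver (multiSym r N) ≅ quiverModuli r N := affIso X.E

include X in
theorem quiver_hom_ext {f g : (∏ᶜ fun k => quiverModuli 1 (n k)) ⟶ quiverModuli r N}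
    (h : ∀ t : ∀ k, Fin (n k) → ℂ,
      Pi.lift (fun k => tuplePoint (diagTuple fun _ => t k)) ≫ f =
        Pi.lift (fun k => tuplePoint (diagTuple fun _ => t k)) ≫ g) : f = g := by
  rw [← cancel_epi X.ηQ.hom, ← cancel_mono X.θQ.inv]
  refine symTensor_hom_ext fun t => ?_
  have := h t
  rw [← X.affMap_evalSym_comp t, Category.assoc, Category.assoc] at this
  simp only [← Category.assoc] at this ⊢
  rw [this]

-- Torus points separate the elements of `SymTensorLoc n`. The target is an arbitrary affine scheme
-- so that the lemma serves both uniqueness of `F` and its comparison with `Φ`.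
include X in
theorem char_hom_ext {Z : Over (Spec (CommRingCat.of ℂ))} {B : Type} [CommRing B] [Algebra ℂ B]
    (α : Z ≅ affOver B) {f g : (∏ᶜ fun k => charVar 1 (n k)) ⟶ Z}
    (h : ∀ s : ∀ k, Fin (n k) → ℂˣ,
      Pi.lift (fun k => charPoint (diagRep fun _ => s k)) ≫ f =
        Pi.lift (fun k => charPoint (diagRep fun _ => s k)) ≫ g) : f = g := by
  rw [← cancel_epi X.η.hom, ← cancel_mono α.hom]
  refine hom_ext_of_points (fun s => evalTensor s) (fun x y => evalTensor_injective) fun s => ?_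
  have := h s
  rw [← X.affMap_evalTensor_comp s, Category.assoc, Category.assoc] at this
  simp only [← Category.assoc] at this ⊢
  rw [this]

theorem evalSym_comp {φ : multiSym r N →ₐ[ℂ] SymTensor n} (hφ : IsSubstitution e φ)
    (t : ∀ k, Fin (n k) → ℂ) : (evalSym t).comp (φ.comp X.E.toAlgHom) =
      evalInv (tupleConj r N) (tupleCoord r N) (tensorTuple e fun k => diagTuple fun _ => t k) := by
  refine AlgHom.ext fun f => ?_
  rw [tensorTuple_diagTuple]
  exact (evalSym_substitution e hφ t (X.E f)).trans (X.aeval_E f fun k i => t k (e.symm i k))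

theorem affMap_evalSym_comp_substitution {φ : multiSym r N →ₐ[ℂ] SymTensor n}
    (hφ : IsSubstitution e φ) (t : ∀ k, Fin (n k) → ℂ) :
    affMap (evalSym t) ≫ affMap (A := multiSym r N) (B := SymTensor n) φ ≫ X.θQ.hom =
      tuplePoint (tensorTuple e fun k => diagTuple fun _ => t k) := by
  refine (congrArg _ (affMap_comp _ _).symm).trans ((affMap_comp _ _).symm.trans
    (congrArg affMap ?_))
  exact X.evalSym_comp e hφ t

include X in
theorem existsUnique_isQuiverTensorization {φ : multiSym r N →ₐ[ℂ] SymTensor n}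
    (hφ : IsSubstitution e φ) :
    ∃! Φ : (∏ᶜ fun k => quiverModuli 1 (n k)) ⟶ quiverModuli r N,
      IsQuiverTensorization e Φ := by
  refine ⟨X.ηQ.inv ≫ affMap (A := multiSym r N) (B := SymTensor n) φ ≫ X.θQ.hom, fun A => ?_,
    fun Φ hΦ => X.quiver_hom_ext fun t => ?_⟩
  -- Source point and target point are unchanged when each `A k` is replaced by a diagonal
  -- degeneration, since tensoring preserves degenerations. There the formula is an evaluation of
  -- `φ`.
  · choose t ht using fun k => exists_degenerates_diagTuple (A k)
    have ht' : ∀ k, Degenerates (A k) (diagTuple fun _ => t k 0) := fun k => by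
      have h : (fun _ => t k 0) = t k := funext fun l => congrArg (t k) (Subsingleton.elim _ _)
      rw [h]
      exact ht k
    have h1 : (fun k => tuplePoint (A k)) = fun k => tuplePoint (diagTuple fun _ => t k 0) :=
      funext fun k => congrArg affMap (evalInv_eq_of_degenerates (ht' k))
    rw [h1, ← X.affMap_evalSym_comp, Category.assoc, Iso.hom_inv_id_assoc]
    rw [X.affMap_evalSym_comp_substitution e hφ]
    exact congrArg affMap
      (evalInv_eq_of_degenerates (Degenerates.tensorTuple e ht')).symm
  · rw [hΦ, ← X.affMap_evalSym_comp, Category.assoc, Iso.hom_inv_id_assoc,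
      X.affMap_evalSym_comp_substitution e hφ]

theorem evalTensor_comp {φ : multiSym r N →ₐ[ℂ] SymTensor n} (hφ : IsSubstitution e φ)
    {φloc : MultiSymLoc r N →ₐ[ℂ] SymTensorLoc n}
    (hloc : ∀ p, φloc (algebraMap _ _ p) = algebraMap _ _ (φ p)) (s : ∀ k, Fin (n k) → ℂˣ) :
    (evalTensor s).comp (φloc.comp X.E'.toAlgHom) =
      evalInv (repConj r N) (repCoord r N) (tensorRep e fun k => diagRep fun _ => s k) := by
  refine algHom_ext_restrictInv (AlgHom.ext fun f => ?_)
  rw [evalInv_comp_restrictInv, toTuple_tensorRep]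
  simp only [toTuple_diagRep]
  rw [← X.evalSym_comp e hφ]
  refine (congrArg (fun y => evalTensor s (φloc y)) (X.E'_restrictInv f)).trans ?_
  rw [hloc, evalTensor_algebraMap]
  rfl

theorem isCharTensorization {φ : multiSym r N →ₐ[ℂ] SymTensor n} (hφ : IsSubstitution e φ)
    {φloc : MultiSymLoc r N →ₐ[ℂ] SymTensorLoc n}
    (hloc : ∀ p, φloc (algebraMap _ _ p) = algebraMap _ _ (φ p)) :
    IsCharTensorization e (X.η.inv ≫ affMap φloc ≫ X.θ.hom) := by
  intro ρ
  -- Again both points depend only on diagonal degenerations, which now have invertible entries.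
  choose t ht using fun k => exists_degenerates_diagRep (ρ k)
  have ht' : ∀ k, Degenerates (toTuple (ρ k)) (toTuple (diagRep fun _ => t k 0)) := fun k => by
    have h : (fun _ => t k 0) = t k := funext fun l => congrArg (t k) (Subsingleton.elim _ _)
    rw [h]
    exact ht k
  have h1 : (fun k => charPoint (ρ k)) = fun k => charPoint (diagRep fun _ => t k 0) :=
    funext fun k => charPoint_eq_of_toTuple (ht' k)
  rw [h1, ← X.affMap_evalTensor_comp, Category.assoc, Iso.hom_inv_id_assoc]
  have h2 : charPoint (tensorRep e ρ) =
      charPoint (tensorRep e fun k => diagRep fun _ => t k 0) :=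
    charPoint_eq_of_toTuple (by
      rw [toTuple_tensorRep, toTuple_tensorRep]
      exact Degenerates.tensorTuple e ht')
  rw [h2]
  refine (congrArg _ (affMap_comp _ _).symm).trans ((affMap_comp _ _).symm.trans
    (congrArg affMap ?_))
  exact X.evalTensor_comp e hφ hloc fun k => t k 0

include X in
theorem isCharTensorization_unique {F F' : (∏ᶜ fun k => charVar 1 (n k)) ⟶ charVar r N}
    (hF : IsCharTensorization e F) (hF' : IsCharTensorization e F') : F = F' :=
  X.char_hom_ext X.θ.symm fun s => by rw [hF, hF']

include X in
theorem map_charToQuiver_comp {Φ : (∏ᶜ fun k => quiverModuli 1 (n k)) ⟶ quiverModuli r N}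
    {F : (∏ᶜ fun k => charVar 1 (n k)) ⟶ charVar r N}
    (hΦ : IsQuiverTensorization e Φ) (hF : IsCharTensorization e F) :
    Limits.Pi.map (fun k => charToQuiver 1 (n k)) ≫ Φ = F ≫ charToQuiver r N := by
  refine X.char_hom_ext X.θQ.symm fun s => ?_
  have h : Pi.lift (fun k => charPoint (diagRep fun _ => s k)) ≫
      Limits.Pi.map (fun k => charToQuiver 1 (n k)) =
        Pi.lift fun k => tuplePoint (toTuple (diagRep fun _ => s k)) :=
    Limits.Pi.hom_ext _ _ fun k => by
      simp only [Category.assoc, Pi.map_π, Pi.lift_π, Pi.lift_π_assoc, charPoint_comp_charToQuiver]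
  rw [← Category.assoc, h, hΦ, ← Category.assoc, hF, charPoint_comp_charToQuiver,
    toTuple_tensorRep]

end ExplicitRings

theorem exists_localized_substitution {φ : multiSym r N →ₐ[ℂ] SymTensor n}
    (hφ : IsSubstitution e φ) : ∃ φloc : MultiSymLoc r N →ₐ[ℂ] SymTensorLoc n,
      ∀ p, φloc (algebraMap _ _ p) = algebraMap _ _ (φ p) := by
  refine ⟨IsLocalization.liftAlgHom (M := Submonoid.powers (multiDet r N))
    (f := (Algebra.algHom ℂ (SymTensor n) (SymTensorLoc n)).comp φ) ?_,
    fun p => IsLocalization.lift_eq _ p⟩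
  rintro ⟨_, m, rfl⟩
  rw [map_pow]
  exact (isUnit_substitution_multiDet e hφ).pow m

end

end SegreChar

end

theorem mainTheorem8 (r : ℕ) (n : Fin r → ℕ) (hn : ∀ k, 0 < n k)
    (e : (∀ k, Fin (n k)) ≃ Fin (∏ k, n k)) :
    -- the character varieties are distinguished open subschemes of the quiver moduli
    (∀ s m : ℕ, IsOpenImmersion (SegreChar.charToQuiver s m).left ∧
      ∃ d : SegreChar.invariants (SegreChar.tupleConj s m) (SegreChar.tupleCoord s m),
        (∀ A, d.1 A = ∏ k, (A.1 k).det) ∧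
        Set.range (SegreChar.charToQuiver s m).left =
          {x : PrimeSpectrum
            (SegreChar.invariants (SegreChar.tupleConj s m) (SegreChar.tupleCoord s m)) |
              d ∉ x.asIdeal}) ∧
    -- the tensorization morphisms and the substitution homomorphism are well defined
    (∃! Φ : (∏ᶜ fun k => SegreChar.quiverModuli 1 (n k)) ⟶ SegreChar.quiverModuli r (∏ k, n k),
      SegreChar.IsQuiverTensorization e Φ) ∧
    (∃! F : (∏ᶜ fun k => SegreChar.charVar 1 (n k)) ⟶ SegreChar.charVar r (∏ k, n k),
      SegreChar.IsCharTensorization e F) ∧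
    (∃! φ : SegreChar.multiSym r (∏ k, n k) →ₐ[ℂ] SegreChar.SymTensor n,
      SegreChar.IsSubstitution e φ) ∧
    ∀ (Φ : (∏ᶜ fun k => SegreChar.quiverModuli 1 (n k)) ⟶ SegreChar.quiverModuli r (∏ k, n k))
      (F : (∏ᶜ fun k => SegreChar.charVar 1 (n k)) ⟶ SegreChar.charVar r (∏ k, n k))
      (φ : SegreChar.multiSym r (∏ k, n k) →ₐ[ℂ] SegreChar.SymTensor n),
      SegreChar.IsQuiverTensorization e Φ → SegreChar.IsCharTensorization e F →
      SegreChar.IsSubstitution e φ →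
      -- `F` is the restriction of `Φ`
      Limits.Pi.map (fun k => SegreChar.charToQuiver 1 (n k)) ≫ Φ =
        F ≫ SegreChar.charToQuiver r (∏ k, n k) ∧
      -- its set-theoretic image is irreducible
      IsIrreducible (Set.range F.left) ∧
      -- its scheme-theoretic image is a closed affine subscheme, supported on the closure
      IsClosedImmersion F.left.imageι ∧ IsAffine F.left.image ∧
      Set.range F.left.imageι = closure (Set.range F.left) ∧
      -- and it is cut out by the kernel of the localization of `φ`
      ∃ (φloc : SegreChar.MultiSymLoc r (∏ k, n k) →ₐ[ℂ] SegreChar.SymTensorLoc n)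
        (θ : SegreChar.affOver (SegreChar.MultiSymLoc r (∏ k, n k)) ≅
          SegreChar.charVar r (∏ k, n k))
        (η : SegreChar.affOver (SegreChar.SymTensorLoc n) ≅
          ∏ᶜ fun k => SegreChar.charVar 1 (n k))
        (ψ : F.left.image ≅
          Spec (CommRingCat.of (SegreChar.MultiSymLoc r (∏ k, n k) ⧸ RingHom.ker φloc))),
        (∀ p, φloc (algebraMap _ _ p) = algebraMap _ _ (φ p)) ∧
        (∀ t, SegreChar.affMap (SegreChar.evalMulti t) ≫ θ.hom =
          SegreChar.charPoint (SegreChar.diagRep t)) ∧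
        (∀ s, SegreChar.affMap (SegreChar.evalTensor s) ≫ η.hom =
          Limits.Pi.lift fun k => SegreChar.charPoint (SegreChar.diagRep fun _ => s k)) ∧
        η.hom ≫ F = SegreChar.affMap φloc ≫ θ.hom ∧
        ψ.hom ≫ Spec.map (CommRingCat.ofHom (Ideal.Quotient.mk (RingHom.ker φloc))) ≫
          θ.hom.left = F.left.imageι := by
  obtain ⟨X⟩ := SegreChar.nonempty_explicitRings n (∏ k, n k)
  have hφ! := SegreChar.existsUnique_isSubstitution e
  refine ⟨fun s m => ⟨SegreChar.isOpenImmersion_charToQuiver s m, SegreChar.detInv s m,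
    fun _ => rfl, SegreChar.range_charToQuiver s m⟩, ?_, ?_, hφ!, ?_⟩
  · exact X.existsUnique_isQuiverTensorization e hφ!.choose_spec.1
  · obtain ⟨φloc, hloc⟩ := SegreChar.exists_localized_substitution e hφ!.choose_spec.1
    exact ⟨_, X.isCharTensorization e hφ!.choose_spec.1 hloc, fun F hF =>
      X.isCharTensorization_unique e hF (X.isCharTensorization e hφ!.choose_spec.1 hloc)⟩
  intro Φ F φ hΦ hF hφ
  obtain ⟨φloc, hloc⟩ := SegreChar.exists_localized_substitution e hφ
  have hηF : X.η.hom ≫ F = SegreChar.affMap φloc ≫ X.θ.hom := by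
    rw [X.isCharTensorization_unique e hF (X.isCharTensorization e hφ hloc),
      Iso.hom_inv_id_assoc]
  -- Images and ranges concern the underlying schemes, so the structure over `Spec ℂ` is forgotten.
  let a := (Over.forget _).mapIso X.η
  let b := (Over.forget _).mapIso X.θ
  have hleft : a.hom ≫ F.left =
      Spec.map (CommRingCat.ofHom φloc.toRingHom) ≫ b.hom := congrArg CommaMorphism.left hηF
  obtain ⟨ψ, hψ⟩ := SegreChar.exists_image_iso F.left a b (CommRingCat.ofHom φloc.toRingHom) hleft
  have : IsIso X.θ.inv.left := inferInstanceAs (IsIso b.inv)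
  have : IsIso X.η.inv.left := inferInstanceAs (IsIso a.inv)
  have : IsIso X.η.hom.left := inferInstanceAs (IsIso a.hom)
  have : IsAffine (SegreChar.charVar r (∏ k, n k)).left := IsAffine.of_isIso X.θ.inv.left
  have : IsAffine (∏ᶜ fun k => SegreChar.charVar 1 (n k)).left :=
    IsAffine.of_isIso X.η.inv.left
  have : IsClosedImmersion F.left.imageι := inferInstance
  refine ⟨X.map_charToQuiver_comp e hΦ hF, ?_, this, isAffine_of_isAffineHom F.left.imageι, ?_,
    φloc, X.θ, X.η, ψ, hloc, X.affMap_evalMulti_comp, X.affMap_evalTensor_comp, hηF, hψ⟩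
  -- The range of `F` is the continuous image of the spectrum of the domain `SymTensorLoc n`.
  · have hsurj : Function.Surjective X.η.hom.left := X.η.hom.left.surjective
    have hrange : Set.range F.left = Set.range (X.η.hom.left ≫ F.left) := by
      rw [Scheme.Hom.comp_base, TopCat.coe_comp, hsurj.range_comp]
    have hirr : IrreducibleSpace (PrimeSpectrum (SegreChar.SymTensorLoc n)) := inferInstance
    rw [hrange, ← Set.image_univ]
    exact (hirr.isIrreducible_univ).image _ (X.η.hom.left ≫ F.left).continuous.continuousOn
  -- A morphism of affine schemes is quasi-compact, so the support of its kernel is the closure of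
  -- its range.
  · rw [Scheme.IdealSheafData.range_subschemeι, Scheme.Hom.support_ker]
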